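/- **Definitions.** All quasi-orders are reflexive and transitive relations. * A quasi-order $Q$ is a *better-quasi-order* (BQO) if for every continuous map $f:[\omega]^\omega\to Q$, where $Q$ is discrete and $[\omega]^\omega$ is the space of infinite subsets of $\omega$, there is $A\in[\omega]^\omega$ such that $f(B)\le_Q f(B\setminus\{\min B\})$ for all infinite $B\subseteq A$. * For a quasi-order $Q$ let $\vec Q=\{X\in Q^\omega : X(k)\not\le_Q X(k+1)\text{ for all }k\in\omega\}$, with the topology of pointwise convergence ($Q$ discrete), viewed as a graph in which $X\ne Y$ are adjacent iff $S(X)=Y$ or $S(Y)=X$, where $S(X)(k)=X(k+1)$. * The *Borel chromatic number* $\chi_B(G)$ of a graph $G$ on a Polish space is the least cardinality of a Polish space $Y$ such that there is a Borel map from the vertices of $G$ to $Y$ taking distinct values on adjacent vertices. * A quasi-order $Q$ is *thin* if it is a BQO and $\chi_B(\vec{Q'})\le 3$ for every countable subset $Q'\subseteq Q$ with the inherited order (for countable $Q$ this just says that $Q$ is a BQO and $\chi_B(\vec Q)\le 3$). * For a cardinal $\kappa$, $Q^{<\kappa}$ is the collection of all $Q$-labelled ordinals $(\alpha,l)$ with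 $\alpha<\kappa$ an ordinal and $l:\alpha\to Q$. Write $(\alpha,l)\le_{emb}(\beta,m)$ if there is a strictly increasing $f:\alpha\to\beta$ with $l(\xi)\le_Q m(f(\xi))$ for all $\xi<\alpha$. **Lemma 3.9.** If $Q$ is thin, then for every cardinal $\kappa$ the quasi-order $(Q^{<\kappa},\le_{emb})$ is thin. -/

import Mathlib

open Topology Cardinal

universe u v

/-! ## Borel graphs and the Borel chromatic number -/

/-- There is a Borel graph homomorphism from `G` to `H`: a Borel map of the vertex spaces that
sends edges to edges. -/
def BorelHom {V : Type u} {W : Type v} [TopologicalSpace V] [TopologicalSpace W]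
    (G : SimpleGraph V) (H : SimpleGraph W) : Prop :=
  ∃ f : V → W, @Measurable V W (borel V) (borel W) f ∧ ∀ x y, G.Adj x y → H.Adj (f x) (f y)

/-- The Borel chromatic number of a graph on a Polish space `V`: the least cardinality of a Polish
space `Y` such that `G` has a Borel homomorphism to the complete graph on `Y`.
When `V` is Polish, `Y = V` is a candidate, so the minimum is over a nonempty class. -/
noncomputable def borelChromaticNumber {V : Type u} [TopologicalSpace V] (G : SimpleGraph V) :
    Cardinal.{u} :=
  sInf {c | ∃ (Y : Type u) (_ : TopologicalSpace Y),
    PolishSpace Y ∧ BorelHom G (⊤ : SimpleGraph Y) ∧ #Y = c}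

/-- The graph generated by a function `f`: distinct `x`, `y` are adjacent iff `f x = y` or
`f y = x`. -/
def functionGraph {V : Type u} (f : V → V) : SimpleGraph V :=
  SimpleGraph.fromRel fun x y => f x = y

/-! ## Better-quasi-orders -/

/-- The space `[ω]^ω` of infinite subsets of `ℕ`, each identified with its strictly increasing
enumeration, with the topology of pointwise convergence. -/
def InfSubset : Type := {x : ℕ → ℕ // StrictMono x}

namespace InfSubset

instance : TopologicalSpace InfSubset :=
  inferInstanceAs (TopologicalSpace {x : ℕ → ℕ // StrictMono x})

/-- The underlying infinite set. -/
def toSet (A : InfSubset) : Set ℕ := Set.range A.1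

/-- The shift `A ↦ A \ {min A}`. -/
def shift (A : InfSubset) : InfSubset :=
  ⟨fun k => A.1 (k + 1), fun _ _ h => A.2 (Nat.succ_lt_succ h)⟩

end InfSubset

/-- `Q` is a better-quasi-order: for every continuous map `f : [ω]^ω → Q`, where `Q` is discrete,
there is an infinite `A` with `f B ≤ f (B \ {min B})` for all infinite `B ⊆ A`. -/
def IsBQO (Q : Type u) [Preorder Q] : Prop :=
  ∀ f : InfSubset → Q, Continuous[inferInstance, ⊥] f →
    ∃ A : InfSubset, ∀ B : InfSubset, B.toSet ⊆ A.toSet → f B ≤ f B.shift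

/-! ## The graph generated by a quasi-order, and thinness -/

/-- The set `{X ∈ Q^ω : ∀ k, X k ≰ X (k + 1)}`. -/
def BadSeq (Q : Type u) [Preorder Q] : Type u :=
  {X : ℕ → Q // ∀ k, ¬ X k ≤ X (k + 1)}

namespace BadSeq

/-- Pointwise convergence, for the discrete topology on `Q`. -/
instance (Q : Type u) [Preorder Q] : TopologicalSpace (BadSeq Q) :=
  TopologicalSpace.induced Subtype.val (@Pi.topologicalSpace ℕ (fun _ => Q) fun _ => ⊥)

/-- The shift `S(X)(k) = X(k + 1)`. -/
def shift {Q : Type u} [Preorder Q] (X : BadSeq Q) : BadSeq Q :=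
  ⟨fun k => X.1 (k + 1), fun k => X.2 (k + 1)⟩

/-- The shift graph on `BadSeq Q`. -/
def graph (Q : Type u) [Preorder Q] : SimpleGraph (BadSeq Q) :=
  functionGraph shift

end BadSeq

/-- `Q` is thin: it is a better-quasi-order, and for every countable subset `Q'` with the inherited
order, the shift graph on its bad sequences has Borel chromatic number at most `3`.
For countable `Q` it is equivalent to ask this of `Q' = Q` only, by restricting a colouring. -/
def IsThin (Q : Type u) [Preorder Q] : Prop :=
  IsBQO Q ∧ ∀ Q' : Set Q, Q'.Countable → borelChromaticNumber (BadSeq.graph Q') ≤ 3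

/-! ## Labelled ordinals -/

/-- The `Q`-labelled ordinals of length less than the cardinal `κ`; an ordinal `len` is regarded
as the well-ordered set of the smaller ordinals. -/
structure LabelledOrdinal (Q : Type u) (κ : Cardinal.{v}) : Type (max u (v + 1)) where
  /-- the underlying ordinal -/
  len : Ordinal.{v}
  len_lt : len < κ.ord
  /-- the labelling -/
  label : Set.Iio len → Q

/-- The quasi-order `≤_emb`: there is a strictly increasing map of the underlying ordinals under
which labels do not decrease. -/
instance LabelledOrdinal.instPreorder (Q : Type u) [Preorder Q] (κ : Cardinal.{v}) :
    Preorder (LabelledOrdinal Q κ) where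
  le a b := ∃ f : Set.Iio a.len → Set.Iio b.len, StrictMono f ∧ ∀ x, a.label x ≤ b.label (f x)
  le_refl _ := ⟨id, strictMono_id, fun _ => le_rfl⟩
  le_trans _ _ _ := fun ⟨f, hf, hfl⟩ ⟨g, hg, hgl⟩ =>
    ⟨g ∘ f, hg.comp hf, fun x => (hfl x).trans (hgl (f x))⟩

-- Thinness is equivalent to one condition, `AlternatesOnBad`: for every countably valued Borel `f`
-- on the Baire space there is a Borel set `P` such that any orbit of the shift along which `f` is
-- bad enters and leaves `P` infinitely often. A finite Borel colouring gives `P` as the set of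
-- points where the colour increases. Conversely, the waiting time until the next exit from `P`
-- gives a Borel 3-colouring. The condition also implies the BQO property: by Galvin–Prikry some
-- increasing sequence has all its subsequences on the same side of `P`, so its orbit cannot
-- alternate.
--
-- Unlike thinness itself, this condition passes easily through constructions. It is preserved by
-- disjoint sums, by finite sequences (a Borel form of the minimal bad sequence argument,
-- `AlternatesOnBad.list`), by well-founded hereditary sets (playing winning strategies against each
-- other, `AlternatesOnBad.hset`), and by pulling back along maps that reflect the relation
-- (`AlternatesOnBad.of_map`).
--
-- Every labelled ordinal is a finite sum of intervals that are single letters or indecomposable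
-- words of limit length, and each such interval is coded by a hereditary set over `Q` and two extra
-- atoms (`exists_decomposes`). If the list of codes of one word is below that of another, then the
-- first word embeds in the second (`Decomposes.wordEmb`), so `of_map` finishes the proof. That the
-- decomposition exists already uses the fact that hereditary sets form a well-quasi-order, which is
-- a weak consequence of `AlternatesOnBad`.

universe w

/-! ## The Galvin–Prikry theorem -/

theorem exists_infinite_subset_forall_mem {D : Finset ℕ → Set ℕ → Prop}
    (mono : ∀ s A B, B ⊆ A → D s A → D s B) {A₀ : Set ℕ}
    (ex : ∀ s A, A ⊆ A₀ → A.Infinite → ∃ B ⊆ A, B.Infinite ∧ D s B) (F : Finset (Finset ℕ))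
    {A : Set ℕ} (hA : A ⊆ A₀) (hA' : A.Infinite) :
    ∃ B ⊆ A, B.Infinite ∧ ∀ s ∈ F, D s B := by
  induction F using Finset.induction_on with
  | empty => exact ⟨A, subset_rfl, hA', by simp⟩
  | insert s F _ ih =>
    obtain ⟨B, hBA, hB, h⟩ := ih
    obtain ⟨C, hCB, hC, hD⟩ := ex s B (hBA.trans hA) hB
    refine ⟨C, hCB.trans hBA, hC, fun t ht => ?_⟩
    rcases Finset.mem_insert.1 ht with rfl | ht
    · exact hD
    · exact mono _ _ _ hCB (h t ht)

/-- The elements of `A` above every element of `s`. -/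
def Set.above (A : Set ℕ) (s : Finset ℕ) : Set ℕ := {n ∈ A | ∀ m ∈ s, m < n}

theorem Set.above_subset (A : Set ℕ) (s : Finset ℕ) : A.above s ⊆ A := fun _ h => h.1

theorem Set.Infinite.above {A : Set ℕ} (hA : A.Infinite) (s : Finset ℕ) :
    (A.above s).Infinite := by
  intro h
  refine hA ((h.union (Set.finite_Iic (s.sup id))).subset fun n hn => ?_)
  by_cases hs : ∀ m ∈ s, m < n
  · exact Or.inl ⟨hn, hs⟩
  · push Not at hs
    obtain ⟨m, hm, hmn⟩ := hs
    exact Or.inr (hmn.trans (Finset.le_sup (f := id) hm))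

/-- Fusion: a property that can be forced for each finite set `s` by shrinking an infinite set
can be forced simultaneously for all finite subsets of one infinite set. -/
theorem exists_fusion {D : Finset ℕ → Set ℕ → Prop}
    (mono : ∀ s A B, B ⊆ A → D s A → D s B) {A₀ : Set ℕ} (hA₀ : A₀.Infinite)
    (ex : ∀ s A, A ⊆ A₀ → A.Infinite → ∃ B ⊆ A, B.Infinite ∧ D s B) :
    ∃ B ⊆ A₀, B.Infinite ∧ ∀ s : Finset ℕ, ↑s ⊆ B → D s (B.above s) := by
  -- One stage drops the minimum of `A` and settles `D s` for the finitely many `s` bounded by it.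
  -- The minima of the successive stages form the diagonal set.
  have step : ∀ A : {A : Set ℕ // A ⊆ A₀ ∧ A.Infinite}, ∃ B : {A : Set ℕ // A ⊆ A₀ ∧ A.Infinite},
      B.1 ⊆ A.1 ∧ (∀ n ∈ B.1, sInf A.1 < n) ∧
        ∀ s : Finset ℕ, (∀ m ∈ s, m ≤ sInf A.1) → D s B.1 := by
    rintro ⟨A, hA, hA'⟩
    have h1 : (A.above {sInf A}).Infinite := hA'.above _
    obtain ⟨B, hBA, hB, hD⟩ := exists_infinite_subset_forall_mem mono ex
      (Finset.range (sInf A + 1)).powerset ((A.above_subset _).trans hA) h1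
    refine ⟨⟨B, (hBA.trans (A.above_subset _)).trans hA, hB⟩, hBA.trans (A.above_subset _),
      fun n hn => (hBA hn).2 _ (Finset.mem_singleton_self _), fun s hs => hD s ?_⟩
    simpa [Finset.subset_iff, Nat.lt_succ_iff] using hs
  choose F hF1 hF2 hF3 using step
  obtain ⟨B₀, hB₀, hB₀', hD₀⟩ := ex ∅ A₀ subset_rfl hA₀
  let A : ℕ → {A : Set ℕ // A ⊆ A₀ ∧ A.Infinite} := fun n => F^[n] ⟨B₀, hB₀, hB₀'⟩
  have hAs : ∀ n, A (n + 1) = F (A n) := fun n => Function.iterate_succ_apply' _ _ _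
  have hanti : ∀ {m n}, m ≤ n → (A n).1 ⊆ (A m).1 := fun {m n} h => by
    induction h with
    | refl => exact subset_rfl
    | step _ ih => rw [hAs]; exact (hF1 _).trans ih
  have hmem : ∀ n, sInf (A n).1 ∈ (A n).1 := fun n => Nat.sInf_mem (A n).2.2.nonempty
  have hmono : StrictMono fun n => sInf (A n).1 := strictMono_nat_of_lt_succ fun n => by
    have := hmem (n + 1)
    rw [hAs] at this
    rw [hAs]
    exact hF2 _ _ this
  refine ⟨Set.range fun n => sInf (A n).1, ?_, Set.infinite_range_of_injective hmono.injective, ?_⟩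
  · rintro _ ⟨n, rfl⟩
    exact (A n).2.1 (hmem n)
  · intro s hs
    rcases s.eq_empty_or_nonempty with rfl | hne
    · refine mono _ _ _ ?_ hD₀
      rintro _ ⟨⟨n, rfl⟩, -⟩
      exact hanti (Nat.zero_le n) (hmem n)
    · obtain ⟨n, hn⟩ := hs (s.max'_mem hne)
      refine mono _ (A (n + 1)).1 _ ?_ ?_
      · rintro _ ⟨⟨k, rfl⟩, hk⟩
        have := hk _ (s.max'_mem hne)
        rw [← hn] at this
        exact hanti (hmono.lt_iff_lt.1 this) (hmem k)
      · rw [hAs]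
        refine hF3 _ _ fun m hm => ?_
        have := s.le_max' m hm
        rw [← hn] at this
        exact this

/-- A family of sets that is open relative to the infinite subsets of `A` has a homogeneous set. -/
theorem exists_homogeneous_of_relOpen {P : Set (Set ℕ)} {A : Set ℕ} (hA : A.Infinite)
    (hP : ∀ X ⊆ A, X.Infinite → X ∈ P →
      ∃ s : Finset ℕ, ↑s ⊆ X ∧ ∀ Y ⊆ A.above s, Y.Infinite → ↑s ∪ Y ∈ P) :
    ∃ B ⊆ A, B.Infinite ∧
      ((∀ Y ⊆ B, Y.Infinite → Y ∈ P) ∨ ∀ Y ⊆ B, Y.Infinite → Y ∉ P) := by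
  let acc (s : Finset ℕ) (B : Set ℕ) : Prop := ∀ Y ⊆ B, Y.Infinite → ↑s ∪ Y ∈ P
  let rej (s : Finset ℕ) (B : Set ℕ) : Prop := ∀ B' ⊆ B, B'.Infinite → ¬ acc s B'
  obtain ⟨B, hBA, hB, hD⟩ := exists_fusion (D := fun s B => acc s B ∨ rej s B)
    (fun s A B hBA h => h.imp (fun h Y hY => h Y (hY.trans hBA))
      fun h C hC => h C (hC.trans hBA)) hA (fun s A _ hA => by
        by_cases h : ∃ B ⊆ A, B.Infinite ∧ acc s B
        · obtain ⟨B, h1, h2, h3⟩ := h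
          exact ⟨B, h1, h2, Or.inl h3⟩
        · push Not at h
          exact ⟨A, subset_rfl, hA, Or.inr h⟩)
  rcases hD ∅ (by simp) with h | h
  · refine ⟨B, hBA, hB, Or.inl fun Y hY hY' => ?_⟩
    simpa using h Y (fun n hn => ⟨hY hn, by simp⟩) hY'
  -- Second fusion: rejection of `s` is made to pass to every `insert n s`. By induction every
  -- finite subset of `C` is then rejected, whereas openness would make some initial part of a
  -- member of `P` accepted.
  obtain ⟨C, hCB, hC, hE⟩ := exists_fusion (A₀ := B)
    (D := fun s C => ↑s ⊆ B → rej s (B.above s) → ∀ n ∈ C, (∀ m ∈ s, m < n) →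
      rej (insert n s) (B.above (insert n s)))
    (fun s A C hCA h h1 h2 n hn => h h1 h2 n (hCA hn)) hB (fun s A hAB hA => by
      by_cases hs : ↑s ⊆ B ∧ rej s (B.above s)
      swap
      · exact ⟨A, subset_rfl, hA, fun h1 h2 => absurd ⟨h1, h2⟩ hs⟩
      let E : Set ℕ := {n ∈ A | (∀ m ∈ s, m < n) ∧ acc (insert n s) (B.above (insert n s))}
      -- Were infinitely many one-point extensions accepted, they would form a set on which `s`
      -- itself is accepted.
      have hE : E.Finite := by
        by_contra hE
        refine hs.2 E (fun n hn => ⟨hAB hn.1, hn.2.1⟩) hE fun Y hY hY' => ?_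
        have hmin := Nat.sInf_mem hY'.nonempty
        have := (hY hmin).2.2 (Y \ {sInf Y}) (fun n hn => ⟨hAB (hY hn.1).1, fun m hm => by
          rcases Finset.mem_insert.1 hm with rfl | hm
          · exact lt_of_le_of_ne (Nat.sInf_le hn.1) (Ne.symm hn.2)
          · exact (hY hn.1).2.1 m hm⟩) (hY'.sdiff (Set.finite_singleton _))
        convert this using 1
        ext n
        simp only [Finset.coe_insert, Set.mem_union, Set.mem_insert_iff, Set.mem_sdiff,
          Set.mem_singleton_iff, Finset.mem_coe]
        by_cases hn : n = sInf Y
        · simp only [hn, hmin, or_true, true_or]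
        · simp [hn]
      refine ⟨A \ E, Set.sdiff_subset, hA.sdiff hE, fun _ _ n hn hsn => ?_⟩
      refine (hD (insert n s) ?_).resolve_left fun h => hn.2 ⟨hn.1, hsn, h⟩
      rw [Finset.coe_insert]
      exact Set.insert_subset (hAB hn.1) hs.1)
  have hrej : ∀ s : Finset ℕ, ↑s ⊆ C → rej s (B.above s) := fun s => by
    induction s using Finset.induction_on_max with
    | empty => exact fun _ => h
    | insert a s hs ih =>
      intro hsC
      rw [Finset.coe_insert, Set.insert_subset_iff] at hsC
      exact hE s hsC.2 (hsC.2.trans hCB) (ih hsC.2) a ⟨hsC.1, hs⟩ hs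
  refine ⟨C, hCB.trans hBA, hC, Or.inr fun Y hY hY' hYP => ?_⟩
  obtain ⟨s, hsY, hs⟩ := hP Y (hY.trans (hCB.trans hBA)) hY' hYP
  exact hrej s (hsY.trans hY) _ subset_rfl (hB.above s)
    fun Z hZ => hs Z fun n hn => ⟨hBA (hZ hn).1, (hZ hn).2⟩

/-- Every set `s ∪ A` can be shrunk, keeping `s`, to one homogeneous for `P`. -/
def CompletelyRamsey (P : Set (Set ℕ)) : Prop :=
  ∀ (s : Finset ℕ) (A : Set ℕ), A.Infinite → ∃ B ⊆ A, B.Infinite ∧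
    ((∀ Y ⊆ B, Y.Infinite → ↑s ∪ Y ∈ P) ∨ ∀ Y ⊆ B, Y.Infinite → ↑s ∪ Y ∉ P)

theorem CompletelyRamsey.compl {P : Set (Set ℕ)} (h : CompletelyRamsey P) :
    CompletelyRamsey Pᶜ := fun s A hA => by
  obtain ⟨B, h1, h2, h3⟩ := h s A hA
  exact ⟨B, h1, h2, h3.symm.imp id fun h Y hY hY' h' => h' (h Y hY hY')⟩

theorem Set.Infinite.exists_initial_finset {X : Set ℕ} (hX : X.Infinite) (n : ℕ) :
    ∃ t : Finset ℕ, t.card = n ∧ X = ↑t ∪ X.above t := by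
  have hinj := Nat.nth_injective (p := (· ∈ X)) hX
  refine ⟨(Finset.range n).image (Nat.nth (· ∈ X)), ?_, ?_⟩
  · rw [Finset.card_image_of_injective _ hinj, Finset.card_range]
  · ext m
    simp only [Finset.coe_image, Finset.coe_range, Set.mem_union, Set.mem_image, Set.mem_Iio,
      Set.above, Set.mem_ofPred_eq, Finset.mem_image, Finset.mem_range, forall_exists_index, and_imp,
      forall_apply_eq_imp_iff₂]
    constructor
    · intro hm
      obtain ⟨k, rfl⟩ : m ∈ Set.range (Nat.nth (· ∈ X)) := by
        rw [Nat.range_nth_of_infinite (p := (· ∈ X)) hX]; exact hm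
      rcases lt_or_ge k n with hk | hk
      · exact Or.inl ⟨k, hk, rfl⟩
      · exact Or.inr ⟨hm, fun j hj => Nat.nth_strictMono hX (hj.trans_le hk)⟩
    · rintro (⟨k, -, rfl⟩ | h)
      · exact Nat.nth_mem_of_infinite hX k
      · exact h.1

/-- After a fusion that decides `P 0, …, P t.card` above each finite `t`, the union is relatively
open: if `X` lies in `P n`, its first `n` elements already force this. -/
theorem CompletelyRamsey.iUnion {P : ℕ → Set (Set ℕ)} (h : ∀ n, CompletelyRamsey (P n)) :
    CompletelyRamsey (⋃ n, P n) := fun s A hA => by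
  obtain ⟨B, hBA, hB, hD⟩ := exists_fusion (D := fun t B => ∀ n ≤ t.card,
      (∀ Y ⊆ B, Y.Infinite → ↑s ∪ (↑t ∪ Y) ∈ P n) ∨ ∀ Y ⊆ B, Y.Infinite → ↑s ∪ (↑t ∪ Y) ∉ P n)
    (fun t A B hBA h n hn => (h n hn).imp (fun h Y hY => h Y (hY.trans hBA))
      fun h Y hY => h Y (hY.trans hBA)) hA (fun t A _ hA => by
        generalize t.card = N
        induction N with
        | zero =>
          obtain ⟨B, h1, h2, h3⟩ := h 0 (s ∪ t) A hA
          refine ⟨B, h1, h2, fun n hn => ?_⟩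
          obtain rfl := Nat.le_zero.1 hn
          simpa only [Finset.coe_union, Set.union_assoc] using h3
        | succ N ih =>
          obtain ⟨C, hCA, hC, h⟩ := ih
          obtain ⟨B, h1, h2, h3⟩ := ‹∀ n, CompletelyRamsey (P n)› (N + 1) (s ∪ t) C hC
          refine ⟨B, h1.trans hCA, h2, fun n hn => ?_⟩
          rcases Nat.lt_or_eq_of_le hn with hn | rfl
          · exact (h n (Nat.lt_succ_iff.1 hn)).imp (fun h Y hY => h Y (hY.trans h1))
              fun h Y hY => h Y (hY.trans h1)
          · simpa only [Finset.coe_union, Set.union_assoc] using h3)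
  obtain ⟨C, hCB, hC, hhom⟩ := exists_homogeneous_of_relOpen
    (P := {Y | ↑s ∪ Y ∈ ⋃ n, P n}) hB (fun X hXB hX hXP => by
      obtain ⟨n, hn⟩ := Set.mem_iUnion.1 hXP
      obtain ⟨t, ht, hXt⟩ := hX.exists_initial_finset n
      have htX : (t : Set ℕ) ⊆ X := by rw [hXt]; exact Set.subset_union_left
      refine ⟨t, htX, fun Y hY hY' => Set.mem_iUnion.2 ⟨n, ?_⟩⟩
      refine (hD t (htX.trans hXB) n ht.ge).resolve_right (fun h => ?_) Y hY hY'
      refine h (X.above t) (fun m hm => ⟨hXB hm.1, hm.2⟩) (hX.above t) ?_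
      rwa [← hXt])
  exact ⟨C, hCB.trans hBA, hC, hhom⟩

/-- Once only elements above `m` are added to `s`, whether `m` is the `k`-th element depends on `s`
alone. -/
theorem completelyRamsey_nth_eq (k m : ℕ) :
    CompletelyRamsey {X : Set ℕ | Nat.nth (· ∈ X) k = m} := fun s A hA => by
  have key : ∀ Y ⊆ A.above {m}, Y.Infinite → ∀ Z ⊆ A.above {m}, Z.Infinite →
      Nat.nth (· ∈ (↑s ∪ Y : Set ℕ)) k = m → Nat.nth (· ∈ (↑s ∪ Z : Set ℕ)) k = m := by
    classical
    intro Y hY hYi Z hZ _ h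
    have hYi' : (Set.ofPred (· ∈ (↑s ∪ Y : Set ℕ))).Infinite := hYi.mono Set.subset_union_right
    have hm : m ∈ (↑s ∪ Y : Set ℕ) := h ▸ Nat.nth_mem_of_infinite hYi' k
    have hagree : ∀ j ≤ m, (j ∈ (↑s ∪ Y : Set ℕ) ↔ j ∈ (↑s ∪ Z : Set ℕ)) := fun j hj => by
      have h1 : j ∉ Y := fun hjY => absurd ((hY hjY).2 m (by simp)) (not_lt.2 hj)
      have h2 : j ∉ Z := fun hjY => absurd ((hZ hjY).2 m (by simp)) (not_lt.2 hj)
      simp [h1, h2]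
    have hk : Nat.count (· ∈ (↑s ∪ Z : Set ℕ)) m = k := by
      rw [← Nat.count_nth_of_infinite hYi' k, h, Nat.count_eq_card_filter_range,
        Nat.count_eq_card_filter_range]
      congr 1
      exact Finset.filter_congr fun j hj => (hagree j (Finset.mem_range.1 hj).le).symm
    rw [← hk]
    exact Nat.nth_count ((hagree m le_rfl).1 hm)
  by_cases h : ∃ Y ⊆ A.above {m}, Y.Infinite ∧ Nat.nth (· ∈ (↑s ∪ Y : Set ℕ)) k = m
  · obtain ⟨Y, h1, h2, h3⟩ := h
    exact ⟨_, A.above_subset {m}, hA.above _, Or.inl fun Z hZ hZ' => key Y h1 h2 Z hZ hZ' h3⟩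
  · push Not at h
    exact ⟨_, A.above_subset {m}, hA.above _, Or.inr h⟩

/-- The sets with the property form a σ-algebra, so the coordinate fibres suffice. -/
theorem completelyRamsey_of_measurableSet {P : Set (ℕ → ℕ)} (hP : MeasurableSet P) :
    CompletelyRamsey {X : Set ℕ | Nat.nth (· ∈ X) ∈ P} := by
  let M : MeasurableSpace (ℕ → ℕ) :=
    { MeasurableSet' := fun P => CompletelyRamsey {X : Set ℕ | Nat.nth (· ∈ X) ∈ P}
      measurableSet_empty := fun s A hA => ⟨A, subset_rfl, hA, Or.inr fun _ _ _ h => h⟩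
      measurableSet_compl := fun P h => h.compl
      measurableSet_iUnion := fun P h => by
        have := CompletelyRamsey.iUnion h
        convert this using 1
        ext X
        simp }
  have hle : MeasurableSpace.pi ≤ M := by
    refine iSup_le fun k => Measurable.comap_le ?_
    exact @measurable_to_countable' ℕ (ℕ → ℕ) _ _ M _ fun m => completelyRamsey_nth_eq k m
  exact hle P hP

/-- The Galvin–Prikry theorem. -/
theorem galvin_prikry {P : Set (ℕ → ℕ)} (hP : MeasurableSet P) :
    ∃ a : ℕ → ℕ, StrictMono a ∧ ((∀ y : ℕ → ℕ, StrictMono y → a ∘ y ∈ P) ∨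
      ∀ y : ℕ → ℕ, StrictMono y → a ∘ y ∉ P) := by
  obtain ⟨A, -, hA, h⟩ := completelyRamsey_of_measurableSet hP ∅ Set.univ Set.infinite_univ
  have ha := Nat.nth_strictMono hA
  have key : ∀ y : ℕ → ℕ, StrictMono y →
      Nat.nth (· ∈ Set.range (Nat.nth (· ∈ A) ∘ y)) = Nat.nth (· ∈ A) ∘ y := fun y hy => by
    have hinf : (Set.range (Nat.nth (· ∈ A) ∘ y)).Infinite :=
      Set.infinite_range_of_injective (ha.comp hy).injective
    exact (StrictMono.range_inj (Nat.nth_strictMono hinf) (ha.comp hy)).1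
      (Nat.range_nth_of_infinite hinf)
  refine ⟨Nat.nth (· ∈ A), ha, h.imp (fun h y hy => ?_) fun h y hy => ?_⟩
  all_goals
    have := h (Set.range (Nat.nth (· ∈ A) ∘ y)) (by
      rintro _ ⟨n, rfl⟩
      exact Nat.nth_mem_of_infinite hA _)
      (Set.infinite_range_of_injective (ha.comp hy).injective)
    simpa only [Finset.coe_empty, Set.empty_union, Set.mem_ofPred_eq, key y hy] using this

/-! ## Countably valued measurable maps and alternating sets on the Baire space -/

open Filter

/-- The shift on the Baire space. -/
def shiftSeq (x : ℕ → ℕ) : ℕ → ℕ := fun k => x (k + 1)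

theorem shiftSeq_iterate_apply (n : ℕ) (x : ℕ → ℕ) (k : ℕ) : shiftSeq^[n] x k = x (k + n) := by
  induction n generalizing x with
  | zero => rfl
  | succ n ih => rw [Function.iterate_succ_apply, ih]; rfl

theorem measurable_shiftSeq : Measurable shiftSeq :=
  measurable_pi_lambda _ fun k => measurable_pi_apply (k + 1)

/-- The forward orbit of `x` meets both `P` and its complement infinitely often. -/
def Alternates (P : Set (ℕ → ℕ)) (x : ℕ → ℕ) : Prop :=
  (∃ᶠ n in atTop, shiftSeq^[n] x ∈ P) ∧ ∃ᶠ n in atTop, shiftSeq^[n] x ∉ P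

theorem eventually_iterate_shiftSeq {p : (ℕ → ℕ) → Prop} {x : ℕ → ℕ} (m : ℕ) :
    (∀ᶠ n in atTop, p (shiftSeq^[n] (shiftSeq^[m] x))) ↔ ∀ᶠ n in atTop, p (shiftSeq^[n] x) := by
  conv_rhs => rw [← Filter.map_add_atTop_eq_nat m, Filter.eventually_map]
  simp only [Function.iterate_add_apply]

theorem alternates_iterate_shiftSeq {P : Set (ℕ → ℕ)} {x : ℕ → ℕ} (m : ℕ) :
    Alternates P (shiftSeq^[m] x) ↔ Alternates P x := by
  simp only [Alternates, Filter.Frequently]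
  rw [eventually_iterate_shiftSeq (p := fun y => ¬ y ∈ P),
    eventually_iterate_shiftSeq (p := fun y => ¬ y ∉ P)]

theorem measurableSet_eventually_mem {A : Set (ℕ → ℕ)} (hA : MeasurableSet A) :
    MeasurableSet {x | ∀ᶠ n in atTop, shiftSeq^[n] x ∈ A} := by
  have : {x | ∀ᶠ n in atTop, shiftSeq^[n] x ∈ A} =
      ⋃ N : ℕ, ⋂ n : ℕ, ⋂ _ : N ≤ n, shiftSeq^[n] ⁻¹' A := by
    ext x; simp [Filter.eventually_atTop]
  rw [this]
  exact MeasurableSet.iUnion fun N => MeasurableSet.iInter fun n => MeasurableSet.iInter fun _ =>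
    (measurable_shiftSeq.iterate n) hA

/-- Either the orbit alternates between `A` and its complement, or it settles in one of them. -/
theorem exists_alternates_of_cases {A P₁ P₂ : Set (ℕ → ℕ)} (hA : MeasurableSet A)
    (h₁ : MeasurableSet P₁) (h₂ : MeasurableSet P₂) :
    ∃ P, MeasurableSet P ∧ ∀ x, ((∀ᶠ n in atTop, shiftSeq^[n] x ∈ A) → Alternates P₁ x) →
      ((∀ᶠ n in atTop, shiftSeq^[n] x ∉ A) → Alternates P₂ x) → Alternates P x := by
  let E₁ := {x | ∀ᶠ n in atTop, shiftSeq^[n] x ∈ A}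
  let E₂ := {x | ∀ᶠ n in atTop, shiftSeq^[n] x ∈ Aᶜ}
  have hE₁ : MeasurableSet E₁ := measurableSet_eventually_mem hA
  have hE₂ : MeasurableSet E₂ := measurableSet_eventually_mem hA.compl
  have i₁ : ∀ n x, shiftSeq^[n] x ∈ E₁ ↔ x ∈ E₁ := fun n x =>
    eventually_iterate_shiftSeq (p := (· ∈ A)) n
  have i₂ : ∀ n x, shiftSeq^[n] x ∈ E₂ ↔ x ∈ E₂ := fun n x =>
    eventually_iterate_shiftSeq (p := (· ∈ Aᶜ)) n
  -- `E₁` and `E₂` are shift invariant, so the set can be chosen separately on each case; outside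
  -- both, `A` itself alternates.
  refine ⟨(E₁ ∩ P₁) ∪ (E₁ᶜ ∩ ((E₂ ∩ P₂) ∪ (E₂ᶜ ∩ A))), ((hE₁.inter h₁).union
    (hE₁.compl.inter ((hE₂.inter h₂).union (hE₂.compl.inter hA)))), fun x hx₁ hx₂ => ?_⟩
  simp only [Alternates, Set.mem_union, Set.mem_inter_iff, Set.mem_compl_iff, i₁, i₂]
  by_cases c₁ : x ∈ E₁
  · simpa [c₁, Alternates] using hx₁ c₁
  by_cases c₂ : x ∈ E₂
  · simpa [c₁, c₂, Alternates] using hx₂ c₂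
  simp only [c₁, c₂, false_and, not_false_eq_true, true_and, false_or]
  exact ⟨fun h => c₂ h, fun h => c₁ (h.mono fun n hn => not_not.1 hn)⟩

variable {C D E : Type*}

/-- `f` takes countably many values, each on a Borel set. -/
structure CountablyMeasurable (f : (ℕ → ℕ) → C) : Prop where
  countable_range : (Set.range f).Countable
  measurableSet_fiber : ∀ c, MeasurableSet (f ⁻¹' {c})

namespace CountablyMeasurable

theorem preimage {f : (ℕ → ℕ) → C} (hf : CountablyMeasurable f) (s : Set C) :
    MeasurableSet (f ⁻¹' s) := by
  have : f ⁻¹' s = ⋃ c ∈ Set.range f ∩ s, f ⁻¹' {c} := by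
    ext x; simp
  rw [this]
  exact MeasurableSet.biUnion (hf.countable_range.mono Set.inter_subset_left)
    fun c _ => hf.measurableSet_fiber c

theorem comp {f : (ℕ → ℕ) → C} (hf : CountablyMeasurable f) (g : C → D) :
    CountablyMeasurable fun x => g (f x) where
  countable_range := by
    rw [show (fun x => g (f x)) = g ∘ f from rfl, Set.range_comp]
    exact hf.countable_range.image g
  measurableSet_fiber c := hf.preimage (g ⁻¹' {c})

theorem map₂ {f : (ℕ → ℕ) → C} {g : (ℕ → ℕ) → D} (hf : CountablyMeasurable f)
    (hg : CountablyMeasurable g) (h : C → D → E) : CountablyMeasurable fun x => h (f x) (g x) := by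
  have : CountablyMeasurable fun x => (f x, g x) :=
    { countable_range := (hf.countable_range.prod hg.countable_range).mono (by
        rintro _ ⟨x, rfl⟩
        exact ⟨⟨x, rfl⟩, ⟨x, rfl⟩⟩)
      measurableSet_fiber := fun c => by
        have : (fun x => (f x, g x)) ⁻¹' {c} = f ⁻¹' {c.1} ∩ g ⁻¹' {c.2} := by
          ext x; simp [Prod.ext_iff]
        rw [this]
        exact (hf.measurableSet_fiber _).inter (hg.measurableSet_fiber _) }
  exact this.comp (fun p => h p.1 p.2)

theorem comp_measurable {f : (ℕ → ℕ) → C} (hf : CountablyMeasurable f) {T : (ℕ → ℕ) → ℕ → ℕ}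
    (hT : Measurable T) : CountablyMeasurable fun x => f (T x) where
  countable_range := hf.countable_range.mono (Set.range_comp_subset_range T f)
  measurableSet_fiber c := hT (hf.measurableSet_fiber c)

theorem const (c : C) : CountablyMeasurable fun _ => c where
  countable_range := (Set.countable_singleton c).mono (by rintro _ ⟨_, rfl⟩; rfl)
  measurableSet_fiber _ := MeasurableSet.const _

theorem apply_zero (e : ℕ → C) : CountablyMeasurable fun x => e (x 0) where
  countable_range := (Set.countable_range e).mono (by rintro _ ⟨x, rfl⟩; exact ⟨x 0, rfl⟩)
  measurableSet_fiber c := (measurable_pi_apply (X := fun _ : ℕ => ℕ) 0)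
    (MeasurableSet.of_discrete (s := e ⁻¹' {c}))

theorem of_eventually_eq {f : ℕ → (ℕ → ℕ) → C} {g : (ℕ → ℕ) → C}
    (hf : ∀ n, CountablyMeasurable (f n)) (h : ∀ x, ∀ᶠ n in atTop, f n x = g x) :
    CountablyMeasurable g where
  countable_range := (Set.countable_iUnion fun n => (hf n).countable_range).mono (by
    rintro _ ⟨x, rfl⟩
    obtain ⟨n, hn⟩ := (h x).exists
    exact Set.mem_iUnion.2 ⟨n, x, hn⟩)
  measurableSet_fiber c := by
    have : g ⁻¹' {c} = ⋃ N : ℕ, ⋂ n : ℕ, ⋂ _ : N ≤ n, f n ⁻¹' {c} := by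
      ext x
      simp only [Set.mem_preimage, Set.mem_singleton_iff, Set.mem_iUnion, Set.mem_iInter]
      rw [← Filter.eventually_atTop (p := fun n => f n x = c)]
      constructor
      · rintro rfl
        exact h x
      · intro h'
        obtain ⟨n, h1, h2⟩ := ((h x).and h').exists
        exact h1.symm.trans h2
    rw [this]
    exact MeasurableSet.iUnion fun N => MeasurableSet.iInter fun n => MeasurableSet.iInter fun _ =>
      (hf n).measurableSet_fiber c

end CountablyMeasurable

/-- For every countably valued Borel `f` on the Baire space, some Borel set alternates along every
orbit on which `f` is `R`-bad. -/
def AlternatesOnBad (R : C → C → Prop) : Prop :=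
  ∀ f : (ℕ → ℕ) → C, CountablyMeasurable f → ∃ P, MeasurableSet P ∧
    ∀ x, (∀ n, ¬ R (f (shiftSeq^[n] x)) (f (shiftSeq^[n + 1] x))) → Alternates P x

/-! ### Closure properties of `AlternatesOnBad`. -/

namespace AlternatesOnBad

/-- Alternation depends only on a tail of the orbit, so badness is needed only on a tail. -/
theorem eventually {R : C → C → Prop} (hR : AlternatesOnBad R) {f : (ℕ → ℕ) → C}
    (hf : CountablyMeasurable f) : ∃ P, MeasurableSet P ∧ ∀ x,
      (∀ᶠ n in atTop, ¬ R (f (shiftSeq^[n] x)) (f (shiftSeq^[n + 1] x))) → Alternates P x := by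
  obtain ⟨P, hP, h⟩ := hR f hf
  refine ⟨P, hP, fun x hx => ?_⟩
  obtain ⟨N, hN⟩ := Filter.eventually_atTop.1 hx
  rw [← alternates_iterate_shiftSeq N]
  refine h _ fun n => ?_
  simp only [← Function.iterate_add_apply]
  rw [show n + 1 + N = n + N + 1 by ring]
  exact hN _ (Nat.le_add_left _ _)

/-- The map `g` may be arbitrary, because composing it with a countably valued Borel function keeps
the fibres Borel. -/
theorem of_map {R : C → C → Prop} {R' : D → D → Prop} (hR' : AlternatesOnBad R') (g : C → D)
    (hg : ∀ a b, R' (g a) (g b) → R a b) : AlternatesOnBad R := fun f hf => by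
  obtain ⟨P, hP, h⟩ := hR' _ (hf.comp g)
  exact ⟨P, hP, fun x hx => h x fun n h => hx n (hg _ _ h)⟩

theorem bool : AlternatesOnBad ((· = ·) : Bool → Bool → Prop) := fun f hf => by
  refine ⟨f ⁻¹' {true}, hf.preimage _, fun x hx => ?_⟩
  simp only [Alternates, Filter.frequently_atTop, Set.mem_preimage, Set.mem_singleton_iff,
    Bool.not_eq_true]
  constructor <;> intro N <;> have := hx N <;> by_cases h : f (shiftSeq^[N] x) = true
  · exact ⟨N, le_rfl, h⟩
  · refine ⟨N + 1, Nat.le_succ N, ?_⟩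
    simp only [Bool.not_eq_true] at h
    simpa [h] using Ne.symm this
  · refine ⟨N + 1, Nat.le_succ N, ?_⟩
    simpa [h] using Ne.symm this
  · exact ⟨N, le_rfl, by simpa using h⟩

theorem sum {R : C → C → Prop} {R' : D → D → Prop} (hR : AlternatesOnBad R)
    (hR' : AlternatesOnBad R') : AlternatesOnBad (Sum.LiftRel R R') := fun f hf => by
  rcases isEmpty_or_nonempty C with hC | ⟨⟨c⟩⟩
  · refine hR'.of_map (Sum.elim (fun c => hC.elim c) id) ?_ f hf
    rintro (a | a) (b | b) h
    exacts [hC.elim a, hC.elim a, hC.elim b, Sum.LiftRel.inr h]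
  rcases isEmpty_or_nonempty D with hD | ⟨⟨d⟩⟩
  · refine hR.of_map (Sum.elim id (fun d => hD.elim d)) ?_ f hf
    rintro (a | a) (b | b) h
    exacts [Sum.LiftRel.inl h, hD.elim b, hD.elim a, hD.elim a]
  -- The dummy value `c` is harmless: `h₁` is used only on orbits whose values eventually lie in the
  -- left summand. Orbits that switch sides forever alternate for that very reason.
  obtain ⟨P₁, hP₁, h₁⟩ := hR.eventually (hf.comp (Sum.elim id fun _ => c))
  obtain ⟨P₂, hP₂, h₂⟩ := hR'.eventually (hf.comp (Sum.elim (fun _ => d) id))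
  obtain ⟨P, hP, h⟩ := exists_alternates_of_cases (hf.preimage (Set.range Sum.inl)) hP₁ hP₂
  refine ⟨P, hP, fun x hx => h x (fun h => h₁ x ?_) fun h => h₂ x ?_⟩
  · filter_upwards [h, (tendsto_add_atTop_nat 1).eventually h]
    rintro n ⟨a, ha⟩ ⟨b, hb⟩ hab
    refine hx n ?_
    rw [← ha, ← hb] at hab ⊢
    exact Sum.LiftRel.inl hab
  · filter_upwards [h, (tendsto_add_atTop_nat 1).eventually h] with n hn hn' hab
    refine hx n ?_
    simp only [Set.mem_preimage] at hn hn'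
    generalize f (shiftSeq^[n] x) = a at hn hab ⊢
    generalize f (shiftSeq^[n + 1] x) = b at hn' hab ⊢
    rcases a with a | a
    · exact absurd ⟨a, rfl⟩ hn
    rcases b with b | b
    · exact absurd ⟨b, rfl⟩ hn'
    exact Sum.LiftRel.inr hab

/-- No orbit of a strictly increasing sequence stays bad in all its subsequences. -/
theorem exists_rel {R : C → C → Prop} (hR : AlternatesOnBad R) {f : (ℕ → ℕ) → C}
    (hf : CountablyMeasurable f) : ∃ x : ℕ → ℕ, StrictMono x ∧ R (f x) (f (shiftSeq x)) := by
  by_contra! hbad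
  obtain ⟨P, hP, h⟩ := hR f hf
  -- All shifts of `a` are subsequences of `a`, hence on the same side of `P`.
  obtain ⟨a, ha, hom⟩ := galvin_prikry hP
  have hit : ∀ n, shiftSeq^[n] a = a ∘ fun k => k + n := fun n =>
    funext fun k => shiftSeq_iterate_apply n a k
  have hmono : ∀ n, StrictMono fun k : ℕ => k + n := fun n _ _ h => Nat.add_lt_add_right h n
  have halt := h a fun n => by
    rw [Function.iterate_succ_apply']
    exact hbad _ (by rw [hit]; exact ha.comp (hmono n))
  rcases hom with hom | hom
  · obtain ⟨n, hn⟩ := halt.2.exists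
    exact hn (by rw [hit]; exact hom _ (hmono n))
  · obtain ⟨n, hn⟩ := halt.1.exists
    exact hom _ (hmono n) (by rw [← hit]; exact hn)

theorem exists_lt_rel {R : C → C → Prop} (hR : AlternatesOnBad R) (e : ℕ → C) :
    ∃ i j, i < j ∧ R (e i) (e j) := by
  obtain ⟨x, hx, h⟩ := hR.exists_rel (CountablyMeasurable.apply_zero e)
  exact ⟨x 0, x 1, hx Nat.zero_lt_one, h⟩

end AlternatesOnBad

/-! ## Finite sequences -/

namespace List

variable {R : C → C → Prop}

theorem SublistForall₂.of_cons {a : C} {l r : List C} (h : SublistForall₂ R (a :: l) r) :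
    SublistForall₂ R l r := by
  generalize hs : a :: l = s at h
  induction h with
  | nil => cases hs
  | cons _ h _ => cases hs; exact h.cons_right
  | cons_right _ ih => exact (ih hs).cons_right

theorem SublistForall₂.of_suffix_left {l l' r : List C} (h : SublistForall₂ R l r)
    (hl : l' <:+ l) : SublistForall₂ R l' r := by
  obtain ⟨t, rfl⟩ := hl
  induction t with
  | nil => exact h
  | cons a t ih => exact ih h.of_cons

theorem SublistForall₂.of_suffix_right {l r r' : List C} (h : SublistForall₂ R l r)
    (hr : r <:+ r') : SublistForall₂ R l r' := by
  obtain ⟨t, h1, h2⟩ := sublistForall₂_iff.1 h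
  exact sublistForall₂_iff.2 ⟨t, h1, h2.trans hr.sublist⟩

open Classical in
/-- The shortest suffix of `l` that is not below `r`, or `l` itself if `l` is below `r`. -/
noncomputable def shortestBadSuffix (R : C → C → Prop) : List C → List C → List C
  | [], _ => []
  | a :: l, r => if SublistForall₂ R l r then a :: l else shortestBadSuffix R l r

theorem shortestBadSuffix_suffix (l r : List C) : shortestBadSuffix R l r <:+ l := by
  induction l with
  | nil => exact suffix_rfl
  | cons a l ih =>
    rw [shortestBadSuffix]
    split_ifs
    · exact suffix_rfl
    · exact ih.trans (suffix_cons a l)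

/-- Enlarging `r` leaves fewer bad suffixes. The default value `l`, the longest suffix, keeps this
monotone when none is left. -/
theorem shortestBadSuffix_mono {r r' : List C} (h : r <:+ r') (l : List C) :
    shortestBadSuffix R l r <:+ shortestBadSuffix R l r' := by
  induction l with
  | nil => exact suffix_rfl
  | cons a l ih =>
    by_cases h' : SublistForall₂ R l r'
    · rw [shortestBadSuffix.eq_2 R r', if_pos h']
      exact shortestBadSuffix_suffix _ _
    · have h'' : ¬ SublistForall₂ R l r := fun h2 => h' (h2.of_suffix_right h)
      rwa [shortestBadSuffix, shortestBadSuffix, if_neg h', if_neg h'']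

theorem exists_shortestBadSuffix_eq_cons {l r : List C} (h : ¬ SublistForall₂ R l r) :
    ∃ a z, shortestBadSuffix R l r = a :: z ∧ ¬ SublistForall₂ R (a :: z) r ∧
      SublistForall₂ R z r := by
  induction l with
  | nil => exact absurd .nil h
  | cons a l ih =>
    rw [shortestBadSuffix]
    split_ifs with h'
    · exact ⟨a, l, rfl, h, h'⟩
    · exact ih h'

theorem shortestBadSuffix_suffix_of_not {l w r : List C} (hw : w <:+ l)
    (h : ¬ SublistForall₂ R w r) : shortestBadSuffix R l r <:+ w := by
  induction l with
  | nil => rw [suffix_nil.1 hw]; exact suffix_rfl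
  | cons a l ih =>
    rcases suffix_cons_iff.1 hw with rfl | hw'
    · exact shortestBadSuffix_suffix _ _
    · rw [shortestBadSuffix, if_neg fun h' => h (h'.of_suffix_left hw')]
      exact ih hw'

end List

open List in
/-- Approximations from below to the minimal bad sequence of suffixes of the lists
`f x, f (shiftSeq x), …`. -/
noncomputable def minimalBadApprox (R : C → C → Prop) (f : (ℕ → ℕ) → List C) :
    ℕ → (ℕ → ℕ) → List C
  | 0, _ => []
  | n + 1, x => shortestBadSuffix R (f x) (minimalBadApprox R f n (shiftSeq x))

namespace minimalBadApprox

open List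

variable (R : C → C → Prop) (f : (ℕ → ℕ) → List C)

theorem suffix (n : ℕ) (x : ℕ → ℕ) : minimalBadApprox R f n x <:+ f x := by
  cases n with
  | zero => exact nil_suffix
  | succ n => exact shortestBadSuffix_suffix _ _

theorem suffix_succ (n : ℕ) (x : ℕ → ℕ) :
    minimalBadApprox R f n x <:+ minimalBadApprox R f (n + 1) x := by
  induction n generalizing x with
  | zero => exact nil_suffix
  | succ n ih => exact shortestBadSuffix_mono (ih _) _

theorem exists_eventually_eq (x : ℕ → ℕ) :
    ∃ l, ∀ᶠ n in atTop, minimalBadApprox R f n x = l := by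
  have hbdd : BddAbove (Set.range fun n => (minimalBadApprox R f n x).length) :=
    ⟨(f x).length, by rintro _ ⟨n, rfl⟩; exact (suffix R f n x).length_le⟩
  obtain ⟨N, hN⟩ := Nat.sSup_mem (Set.range_nonempty _) hbdd
  refine ⟨minimalBadApprox R f N x, Filter.eventually_atTop.2 ⟨N, fun n hn => ?_⟩⟩
  have hsuf : minimalBadApprox R f N x <:+ minimalBadApprox R f n x := by
    induction n, hn using Nat.le_induction with
    | base => exact suffix_rfl
    | succ n _ ih => exact ih.trans (suffix_succ R f n x)
  refine (hsuf.eq_of_length_le ?_).symm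
  exact (le_csSup hbdd ⟨n, rfl⟩).trans hN.ge

/-- The minimal bad sequence of suffixes. -/
noncomputable def lim (x : ℕ → ℕ) : List C := (exists_eventually_eq R f x).choose

theorem eventually_eq_lim (x : ℕ → ℕ) : ∀ᶠ n in atTop, minimalBadApprox R f n x = lim R f x :=
  (exists_eventually_eq R f x).choose_spec

theorem lim_suffix (x : ℕ → ℕ) : lim R f x <:+ f x := by
  obtain ⟨n, hn⟩ := (eventually_eq_lim R f x).exists
  exact hn ▸ suffix R f n x

theorem lim_eq (x : ℕ → ℕ) : lim R f x = shortestBadSuffix R (f x) (lim R f (shiftSeq x)) := by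
  obtain ⟨n, h1, h2⟩ := (((tendsto_add_atTop_nat 1).eventually (eventually_eq_lim R f x)).and
    (eventually_eq_lim R f (shiftSeq x))).exists
  rw [← h1, ← h2]
  rfl

/-- Any bad sequence of suffixes lies above the minimal one. -/
theorem lim_suffix_of_bad (x : ℕ → ℕ) (w : ℕ → List C) (hw : ∀ k, w k <:+ f (shiftSeq^[k] x))
    (hbad : ∀ k, ¬ SublistForall₂ R (w k) (w (k + 1))) : lim R f x <:+ w 0 := by
  have key : ∀ n k, minimalBadApprox R f n (shiftSeq^[k] x) <:+ w k := fun n => by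
    induction n with
    | zero => exact fun _ => nil_suffix
    | succ n ih =>
      intro k
      refine shortestBadSuffix_suffix_of_not (hw k) fun h => hbad k (h.of_suffix_right ?_)
      rw [← Function.iterate_succ_apply' shiftSeq]
      exact ih (k + 1)
  obtain ⟨n, hn⟩ := (eventually_eq_lim R f x).exists
  exact hn ▸ key n 0

variable {f} in
theorem countablyMeasurable (hf : CountablyMeasurable f) (n : ℕ) :
    CountablyMeasurable (minimalBadApprox R f n) := by
  induction n with
  | zero => exact CountablyMeasurable.const []
  | succ n ih => exact hf.map₂ (ih.comp_measurable measurable_shiftSeq) (shortestBadSuffix R)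

variable {f} in
theorem countablyMeasurable_lim (hf : CountablyMeasurable f) : CountablyMeasurable (lim R f) :=
  .of_eventually_eq (countablyMeasurable R hf) (eventually_eq_lim R f)

end minimalBadApprox

open List minimalBadApprox in
/-- The analogue of Higman's lemma. -/
theorem AlternatesOnBad.list [Inhabited C] {R : C → C → Prop} (hR : AlternatesOnBad R) :
    AlternatesOnBad (List.SublistForall₂ R) := fun f hf => by
  have hq : CountablyMeasurable fun x => (lim R f x).headI :=
    (countablyMeasurable_lim R hf).comp _
  obtain ⟨P₂, hP₂, h₂⟩ := hR.eventually hq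
  -- The cases depend on whether consecutive heads of the minimal bad sequence are related.
  have hA := (hq.map₂ (hq.comp_measurable measurable_shiftSeq) R).preimage {True}
  obtain ⟨P, hP, h⟩ := exists_alternates_of_cases hA MeasurableSet.empty hP₂
  refine ⟨P, hP, fun x hx => h x (fun h => ?_) fun h => h₂ x ?_⟩
  · exfalso
    obtain ⟨N, hN⟩ := Filter.eventually_atTop.1 h
    have hbad : ∀ k, ¬ SublistForall₂ R (f (shiftSeq^[k] x)) (lim R f (shiftSeq^[k + 1] x)) :=
      fun k h => hx k (h.of_suffix_right (lim_suffix R f _))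
    have hz : ∀ k, ∃ a z, lim R f (shiftSeq^[k] x) = a :: z ∧
        ¬ SublistForall₂ R (a :: z) (lim R f (shiftSeq^[k + 1] x)) := fun k => by
      obtain ⟨a, z, h1, h2, -⟩ := exists_shortestBadSuffix_eq_cons (hbad k)
      rw [Function.iterate_succ_apply', ← lim_eq] at h1
      exact ⟨a, z, h1, h2⟩
    choose a z haz hbad' using hz
    have hle : ∀ k ≥ N, R (a k) (a (k + 1)) := fun k hk => by
      have : R (lim R f _).headI (lim R f (shiftSeq (shiftSeq^[k] x))).headI :=
        of_eq_true (hN k hk)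
      rw [← Function.iterate_succ_apply' shiftSeq] at this
      simpa only [haz, headI_cons] using this
    -- If the heads are related from `N` on, the tails `z` form a bad sequence of suffixes, so
    -- minimality makes `a N :: z N` a suffix of `z N`.
    have := lim_suffix_of_bad R f (shiftSeq^[N] x) (fun k => z (k + N)) (fun k => by
      rw [← Function.iterate_add_apply]
      refine (suffix_cons (a (k + N)) _).trans ?_
      rw [← haz]
      exact lim_suffix R f _) (fun k hk => by
      refine hbad' (k + N) ?_
      rw [haz]
      refine SublistForall₂.cons (hle _ (Nat.le_add_left _ _)) ?_
      rwa [show k + N + 1 = k + 1 + N by ring])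
    simp only [haz, zero_add] at this
    exact absurd this.length_le (by simp)
  · filter_upwards [h] with n hn hR'
    refine hn ?_
    rw [Function.iterate_succ_apply'] at hR'
    exact eq_true hR'

/-! ## Hereditary sets -/

/-- Well-founded trees with leaves in `C`, thought of as hereditary sets over the atoms `C`. -/
inductive HSet (C : Type u) : Type (max u (w + 1))
  | atom (c : C) : HSet C
  | node (ι : Type w) (ch : ι → HSet C) : HSet C

namespace HSet

variable {C : Type u} {R : C → C → Prop}

/-- Player I wins the game for `s ≤ t`, in which the players alternately pass to elements of
`s` and `t` until they reach atoms, which player I wants to be `R`-unrelated. -/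
inductive NotLE (R : C → C → Prop) : HSet.{u, w} C → HSet.{u, w} C → Prop
  | atom_atom {a b : C} : ¬ R a b → NotLE R (atom a) (atom b)
  | atom_node {a : C} {ι : Type w} {ch : ι → HSet C} :
      (∀ j, NotLE R (atom a) (ch j)) → NotLE R (atom a) (node ι ch)
  | node_atom {ι : Type w} {ch : ι → HSet C} {b : C} (i : ι) :
      NotLE R (ch i) (atom b) → NotLE R (node ι ch) (atom b)
  | node_node {ι κ : Type w} {ch : ι → HSet C} {ch' : κ → HSet C} (i : ι) :
      (∀ j, NotLE R (ch i) (ch' j)) → NotLE R (node ι ch) (node κ ch')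

/-- The order in which `s ≤ t` when player II wins the game. -/
def Le (R : C → C → Prop) (s t : HSet.{u, w} C) : Prop := ¬ NotLE R s t

theorem le_atom_atom {a b : C} : Le R (atom a : HSet.{u, w} C) (atom b) ↔ R a b :=
  ⟨fun h => by_contra fun h' => h (.atom_atom h'), fun h h' => by cases h'; contradiction⟩

theorem le_atom_node {a : C} {ι : Type w} {ch : ι → HSet C} :
    Le R (atom a) (node ι ch) ↔ ∃ j, Le R (atom a) (ch j) := by
  refine ⟨fun h => by_contra fun h' => h (.atom_node fun j => ?_), ?_⟩
  · by_contra h2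
    exact h' ⟨j, h2⟩
  · rintro ⟨j, hj⟩ h
    cases h with
    | atom_node h => exact hj (h j)

theorem le_node_atom {ι : Type w} {ch : ι → HSet C} {b : C} :
    Le R (node ι ch) (atom b) ↔ ∀ i, Le R (ch i) (atom b) := by
  refine ⟨fun h i hi => h (.node_atom i hi), fun h h' => ?_⟩
  cases h' with
  | node_atom i hi => exact h i hi

theorem le_node_node {ι κ : Type w} {ch : ι → HSet C} {ch' : κ → HSet C} :
    Le R (node ι ch) (node κ ch') ↔ ∀ i, ∃ j, Le R (ch i) (ch' j) := by
  refine ⟨fun h i => by_contra fun h' => h (.node_node i fun j => ?_), fun h h' => ?_⟩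
  · by_contra h2
    exact h' ⟨j, h2⟩
  · cases h' with
    | node_node i hi =>
      obtain ⟨j, hj⟩ := h i
      exact hj (hi j)

/-- The positions to which a player can pass; an atom is never left. -/
def moves : HSet.{u, w} C → Set (HSet.{u, w} C)
  | atom c => {atom c}
  | node _ ch => Set.range ch

theorem NotLE.exists_move {s t : HSet.{u, w} C} (h : NotLE R s t) :
    ∃ s' ∈ s.moves, ∀ t' ∈ t.moves, NotLE R s' t' := by
  cases h with
  | atom_atom h => exact ⟨_, rfl, by rintro _ rfl; exact .atom_atom h⟩
  | atom_node h => exact ⟨_, rfl, by rintro _ ⟨j, rfl⟩; exact h j⟩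
  | node_atom i h => exact ⟨_, ⟨i, rfl⟩, by rintro _ rfl; exact h⟩
  | node_node i h => exact ⟨_, ⟨i, rfl⟩, by rintro _ ⟨j, rfl⟩; exact h j⟩

/-- `s` is an element of `t`. -/
inductive IsChild : HSet.{u, w} C → HSet.{u, w} C → Prop
  | mk {ι : Type w} (ch : ι → HSet C) (i : ι) : IsChild (ch i) (node ι ch)

theorem wellFounded_isChild : WellFounded (IsChild (C := C)) := by
  refine ⟨fun s => ?_⟩
  induction s with
  | atom c => exact ⟨_, by rintro _ ⟨⟩⟩
  | node ι ch ih => exact ⟨_, by rintro _ ⟨_, i⟩; exact ih i⟩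

theorem eq_or_isChild_of_mem_moves {s t : HSet.{u, w} C} (h : s ∈ t.moves) :
    s = t ∨ IsChild s t := by
  cases t with
  | atom c => exact Or.inl h
  | node ι ch =>
    obtain ⟨i, rfl⟩ := h
    exact Or.inr (.mk ch i)

theorem exists_atom_of_mem_moves_self {s : HSet.{u, w} C} (h : s ∈ s.moves) :
    ∃ c, s = atom c := by
  cases s with
  | atom c => exact ⟨c, rfl⟩
  | node ι ch =>
    obtain ⟨i, hi⟩ := h
    have := IsChild.mk ch i
    rw [hi] at this
    exact absurd this (wellFounded_isChild.irrefl.irrefl _)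

theorem exists_eventually_eq_of_step {u : ℕ → HSet.{u, w} C}
    (hu : ∀ n, u (n + 1) = u n ∨ IsChild (u (n + 1)) (u n)) :
    ∃ s, ∀ᶠ n in atTop, u n = s := by
  have key : ∀ s n, u n = s → ∃ t, ∀ᶠ n in atTop, u n = t := fun s => by
    induction s using wellFounded_isChild.induction with
    | _ s ih =>
      intro n hn
      by_cases h : ∀ m ≥ n, u m = s
      · exact ⟨s, Filter.eventually_atTop.2 ⟨n, h⟩⟩
      · push Not at h
        classical
        obtain ⟨h1, h2⟩ := Nat.find_spec h
        obtain ⟨k, hk⟩ : ∃ k, Nat.find h = k + 1 := by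
          refine Nat.exists_eq_succ_of_ne_zero fun h0 => ?_
          rw [h0] at h1 h2
          obtain rfl := Nat.le_zero.1 h1
          exact h2 hn
        rw [hk] at h1 h2
        have hks : u k = s := by
          by_contra hks
          refine Nat.find_min h (m := k) (by omega) ⟨?_, hks⟩
          by_contra hlt
          have : n = k + 1 := by omega
          exact h2 (this ▸ hn)
        refine ih (u (k + 1)) ?_ (k + 1) rfl
        rcases hu k with h | h
        · exact absurd (h.trans hks) h2
        · rwa [hks] at h
  exact key _ 0 rfl

open Classical in
/-- A winning move of player I in the game for `s ≤ t`, or `s` itself if there is none. -/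
noncomputable def winningMove (R : C → C → Prop) (s t : HSet.{u, w} C) : HSet.{u, w} C :=
  if h : NotLE R s t then h.exists_move.choose else s

theorem winningMove_mem {s t : HSet.{u, w} C} (h : NotLE R s t) : winningMove R s t ∈ s.moves := by
  rw [winningMove, dif_pos h]
  exact h.exists_move.choose_spec.1

theorem notLE_winningMove {s t t' : HSet.{u, w} C} (h : NotLE R s t) (ht : t' ∈ t.moves) :
    NotLE R (winningMove R s t) t' := by
  rw [winningMove, dif_pos h]
  exact h.exists_move.choose_spec.2 t' ht

theorem winningMove_eq_or_isChild (s t : HSet.{u, w} C) :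
    winningMove R s t = s ∨ IsChild (winningMove R s t) s := by
  by_cases h : NotLE R s t
  · exact eq_or_isChild_of_mem_moves (winningMove_mem h)
  · rw [winningMove, dif_neg h]
    exact Or.inl rfl

/-- The positions of player I when the winning strategies for `f x ≰ f (shiftSeq x)`,
`f (shiftSeq x) ≰ f (shiftSeq^[2] x)`, … are played against each other. -/
noncomputable def play (R : C → C → Prop) (f : (ℕ → ℕ) → HSet.{u, w} C) :
    ℕ → (ℕ → ℕ) → HSet.{u, w} C
  | 0, x => f x
  | n + 1, x => winningMove R (play R f n x) (play R f n (shiftSeq x))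

theorem exists_eventually_play_eq (R : C → C → Prop) (f : (ℕ → ℕ) → HSet.{u, w} C) (x : ℕ → ℕ) :
    ∃ s, ∀ᶠ n in atTop, play R f n x = s :=
  exists_eventually_eq_of_step fun _ => winningMove_eq_or_isChild _ _

theorem countablyMeasurable_play {f : (ℕ → ℕ) → HSet.{u, w} C} (hf : CountablyMeasurable f)
    (n : ℕ) : CountablyMeasurable (play R f n) := by
  induction n with
  | zero => exact hf
  | succ n ih => exact ih.map₂ (ih.comp_measurable measurable_shiftSeq) (winningMove R)

/-- The atom `s`, or a default value if `s` is not an atom. -/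
def label [Inhabited C] : HSet.{u, w} C → C
  | atom c => c
  | node _ _ => default

end HSet

open HSet in
-- On a bad orbit player I wins the game between each pair of consecutive sets. All these games are
-- played at once, player I's move in each game being copied as player II's move in the preceding
-- one. By well-foundedness the positions stabilise, necessarily at atoms, and these form an `R`-bad
-- sequence.
theorem AlternatesOnBad.hset {C : Type u} [Inhabited C] {R : C → C → Prop}
    (hR : AlternatesOnBad R) : AlternatesOnBad (HSet.Le.{u, w} R) := fun f hf => by
  choose g hg using exists_eventually_play_eq R f
  have hgm : CountablyMeasurable g := .of_eventually_eq (countablyMeasurable_play hf) hg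
  obtain ⟨P, hP, h⟩ := hR _ (hgm.comp HSet.label)
  refine ⟨P, hP, fun x hx => h x fun k => ?_⟩
  have hplay : ∀ n k, NotLE R (play R f n (shiftSeq^[k] x)) (play R f n (shiftSeq^[k + 1] x)) :=
    fun n => by
      induction n with
      | zero => exact fun k => not_not.1 (hx k)
      | succ n ih =>
        intro k
        have h1 := ih k
        have h2 := winningMove_mem (ih (k + 1))
        rw [Function.iterate_succ_apply' shiftSeq k] at h1 ⊢
        rw [Function.iterate_succ_apply' shiftSeq (k + 1),
          Function.iterate_succ_apply' shiftSeq k] at h2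
        exact notLE_winningMove h1 h2
  have hgk : ∀ k, NotLE R (g (shiftSeq^[k] x)) (g (shiftSeq^[k + 1] x)) := fun k => by
    obtain ⟨n, h1, h2⟩ := ((hg (shiftSeq^[k] x)).and (hg (shiftSeq^[k + 1] x))).exists
    rw [← h1, ← h2]
    exact hplay n k
  -- A stable position is its own winning move, and only an atom can be moved to itself.
  have hatom : ∀ k, ∃ c, g (shiftSeq^[k] x) = atom c := fun k => by
    refine exists_atom_of_mem_moves_self ?_
    have hk := winningMove_mem (hgk k)
    obtain ⟨n, h1, h2, h3⟩ := (((tendsto_add_atTop_nat 1).eventually (hg (shiftSeq^[k] x))).and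
      ((hg (shiftSeq^[k] x)).and (hg (shiftSeq^[k + 1] x)))).exists
    rw [Function.iterate_succ_apply' shiftSeq k] at h3 hk
    have h4 : winningMove R (g (shiftSeq^[k] x)) (g (shiftSeq (shiftSeq^[k] x))) =
        g (shiftSeq^[k] x) := by
      rw [← h1, ← h3]
      conv_lhs => rw [h1, ← h2]
      rfl
    rwa [h4] at hk
  obtain ⟨a, ha⟩ := hatom k
  obtain ⟨b, hb⟩ := hatom (k + 1)
  have := hgk k
  rw [ha, hb] at this ⊢
  cases this with
  | atom_atom h => exact h

/-! ## Labelled intervals of ordinals -/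

/-- The word `l` on `[a, b)` embeds in the word `m` on `[c, d)`. -/
def WordEmb {Q : Type u} [Preorder Q] (l : Ordinal.{v} → Q) (a b : Ordinal.{v})
    (m : Ordinal.{v} → Q) (c d : Ordinal.{v}) : Prop :=
  ∃ f : Ordinal.{v} → Ordinal.{v}, StrictMonoOn f (Set.Ico a b) ∧
    ∀ x ∈ Set.Ico a b, f x ∈ Set.Ico c d ∧ l x ≤ m (f x)

namespace WordEmb

variable {Q : Type u} [Preorder Q] {l m : Ordinal.{v} → Q} {a b c d e z x y : Ordinal.{v}}

theorem of_empty (l m : Ordinal.{v} → Q) (a c d : Ordinal.{v}) : WordEmb l a a m c d :=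
  ⟨id, strictMono_id.strictMonoOn _, fun x hx => by simp at hx⟩

theorem mono (h : WordEmb l a b m c d) (hc : z ≤ c) (hd : d ≤ e) : WordEmb l a b m z e := by
  obtain ⟨f, h1, h2⟩ := h
  exact ⟨f, h1, fun x hx =>
    ⟨⟨hc.trans (h2 x hx).1.1, (h2 x hx).1.2.trans_le hd⟩, (h2 x hx).2⟩⟩

theorem append (h₁ : WordEmb l a x m c z) (h₂ : WordEmb l x b m z d) (hcz : c ≤ z) (hzd : z ≤ d) :
    WordEmb l a b m c d := by
  obtain ⟨f, f1, f2⟩ := h₁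
  obtain ⟨g, g1, g2⟩ := h₂
  refine ⟨fun y => if y < x then f y else g y, fun y hy y' hy' hlt => ?_, fun y hy => ?_⟩
  · dsimp only
    by_cases h1 : y < x <;> by_cases h2 : y' < x
    · rw [if_pos h1, if_pos h2]
      exact f1 ⟨hy.1, h1⟩ ⟨hy'.1, h2⟩ hlt
    · rw [if_pos h1, if_neg h2]
      exact (f2 y ⟨hy.1, h1⟩).1.2.trans_le (g2 y' ⟨not_lt.1 h2, hy'.2⟩).1.1
    · exact absurd (hlt.trans h2) h1
    · rw [if_neg h1, if_neg h2]
      exact g1 ⟨not_lt.1 h1, hy.2⟩ ⟨not_lt.1 h2, hy'.2⟩ hlt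
  · dsimp only
    by_cases h1 : y < x
    · rw [if_pos h1]
      have := f2 y ⟨hy.1, h1⟩
      exact ⟨⟨this.1.1, this.1.2.trans_le hzd⟩, this.2⟩
    · rw [if_neg h1]
      have := g2 y ⟨not_lt.1 h1, hy.2⟩
      exact ⟨⟨hcz.trans this.1.1, this.1.2⟩, this.2⟩

/-- The greedy embedding shows that a word of limit length embeds once its proper prefixes do. -/
theorem of_forall_lt (hb : Order.IsSuccLimit b)
    (h : ∀ x, a ≤ x → x < b → WordEmb l a x m c d) : WordEmb l a b m c d := by
  -- `g x` is the least admissible position after all earlier values of `g`.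
  let S (x : Ordinal.{v}) (g : ∀ y, y < x → Ordinal.{v}) : Set Ordinal.{v} :=
    {y | c ≤ y ∧ l x ≤ m y ∧ ∀ x' (hx' : x' < x), a ≤ x' → g x' hx' < y}
  let g : Ordinal.{v} → Ordinal.{v} :=
    (Ordinal.lt_wf : WellFounded ((· < ·) : Ordinal.{v} → _ → Prop)).fix fun x g => sInf (S x g)
  have hg : ∀ x, g x = sInf (S x fun y _ => g y) := fun x => WellFounded.fix_eq _ _ _
  -- The greedy map stays at or below every embedding of a prefix, so it never runs out of room.
  have key : ∀ f : Ordinal.{v} → Ordinal.{v}, ∀ x, StrictMonoOn f (Set.Icc a x) →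
      (∀ y ∈ Set.Icc a x, c ≤ f y ∧ l y ≤ m (f y)) → a ≤ x →
        f x ∈ S x (fun y _ => g y) ∧ g x ≤ f x := fun f x => by
    induction x using Ordinal.lt_wf.induction with
    | _ x ih =>
      intro hf hlab hax
      have hmem : f x ∈ S x fun y _ => g y := by
        refine ⟨(hlab x ⟨hax, le_rfl⟩).1, (hlab x ⟨hax, le_rfl⟩).2, fun x' hx' hax' => ?_⟩
        have hsub : Set.Icc a x' ⊆ Set.Icc a x := Set.Icc_subset_Icc_right hx'.le
        exact (ih x' hx' (hf.mono hsub) (fun y hy => hlab y (hsub hy)) hax').2.trans_lt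
          (hf ⟨hax', hx'.le⟩ ⟨hax, le_rfl⟩ hx')
      exact ⟨hmem, (hg x).trans_le (csInf_le' hmem)⟩
  have key' : ∀ x ∈ Set.Ico a b, g x ∈ S x (fun y _ => g y) ∧ g x < d := fun x hx => by
    obtain ⟨f, f1, f2⟩ := h (Order.succ x) (hx.1.trans (Order.le_succ x)) (hb.succ_lt hx.2)
    have hsub : Set.Icc a x ⊆ Set.Ico a (Order.succ x) :=
      fun y hy => ⟨hy.1, Order.lt_succ_of_le hy.2⟩
    obtain ⟨h1, h2⟩ := key f x (f1.mono hsub)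
      (fun y hy => ⟨(f2 y (hsub hy)).1.1, (f2 y (hsub hy)).2⟩) hx.1
    refine ⟨?_, h2.trans_lt (f2 x (hsub ⟨hx.1, le_rfl⟩)).1.2⟩
    rw [hg]
    exact csInf_mem ⟨_, h1⟩
  refine ⟨g, fun x hx y hy hlt => (key' y hy).1.2.2 x hlt hx.1, fun x hx => ?_⟩
  exact ⟨⟨(key' x hx).1.1, (key' x hx).2⟩, (key' x hx).1.2.1⟩

end WordEmb

/-! ## Indecomposable words as hereditary sets -/

section Words

variable {Q : Type u} [Preorder Q]

/-- Hereditary sets over `Q` and two extra atoms, which are put in every set that represents a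
word, so that no such set lies below an atom. -/
abbrev WordSet (Q : Type u) := HSet.{u, v + 1} (Q ⊕ Bool)

/-- The order on `Q ⊕ Bool` in which the two extra atoms are unrelated to everything else. -/
abbrev atomRel (Q : Type u) [Preorder Q] : Q ⊕ Bool → Q ⊕ Bool → Prop :=
  Sum.LiftRel (· ≤ ·) (· = ·)

namespace WordSet

open HSet

/-- The two extra atoms are elements of every set in the transitive closure of `h`. -/
def Starred : WordSet.{u, v} Q → Prop
  | atom _ => True
  | node ι ch => (∀ t : Bool, ∃ i : ι, ch i = atom (Sum.inr t)) ∧ ∀ i, Starred (ch i)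

/-- The word on `[a, b)` is bounded above by `h`: it is a letter below the atom `h`, or each of its
proper prefixes is a finite sum of words bounded by elements of `h`. -/
def Bounds (l : Ordinal.{v} → Q) : WordSet.{u, v} Q → Ordinal.{v} → Ordinal.{v} → Prop
  | atom (Sum.inl q), a, b => b = Order.succ a ∧ l a ≤ q
  | atom (Sum.inr _), _, _ => False
  | node _ ch, a, b => Order.IsSuccLimit b ∧ ∀ c, a ≤ c → c < b →
      Relation.ReflTransGen (fun x y => ∃ i, Bounds l (ch i) x y) a c

/-- The word on `[a, b)` is bounded below by `h`: it has a letter above the atom `h`, or each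
element of `h` bounds below cofinally many bounded intervals of it. -/
def BoundedBelow (l : Ordinal.{v} → Q) : WordSet.{u, v} Q → Ordinal.{v} → Ordinal.{v} → Prop
  | atom (Sum.inl q), a, b => ∃ y, a ≤ y ∧ y < b ∧ q ≤ l y
  | atom (Sum.inr _), _, _ => True
  | node _ ch, a, b => a < b ∧ ∀ i c, a ≤ c → c < b →
      ∃ d e, c ≤ d ∧ d ≤ e ∧ e < b ∧ BoundedBelow l (ch i) d e

variable {l m : Ordinal.{v} → Q} {a b c d : Ordinal.{v}}

/-- An atom above the set would lie above both extra atoms, which are unrelated. -/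
theorem not_le_atom_of_starred {ι : Type (v + 1)} {ch : ι → WordSet.{u, v} Q}
    (hs : Starred (node ι ch)) (t : Q ⊕ Bool) : ¬ Le (atomRel Q) (node ι ch) (atom t) := by
  intro h
  rw [le_node_atom] at h
  have key : ∀ s : Bool, atomRel Q (Sum.inr s) t := fun s => by
    obtain ⟨i, hi⟩ := hs.1 s
    have := h i
    rwa [hi, le_atom_atom] at this
  cases key true with
  | inr h1 => cases key false with | inr h2 => exact absurd (h1.trans h2.symm) (by decide)

theorem BoundedBelow.mono_interval {h : WordSet.{u, v} Q} {q : Q}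
    (hh : h = atom (Sum.inl q)) (hb : BoundedBelow l h c d) (hc : a ≤ c) (hd : d ≤ b) :
    BoundedBelow l h a b := by
  subst hh
  obtain ⟨y, h1, h2, h3⟩ := hb
  exact ⟨y, hc.trans h1, h2.trans_le hd, h3⟩

/-- Elements of `h` are dominated by elements of `h'`, which recur cofinally. The stars exclude a
set lying below an atom, where a single letter would give no recurrence. -/
theorem BoundedBelow.of_le {h h' : WordSet.{u, v} Q} (hs : Starred h)
    (hle : Le (atomRel Q) h h') (hb : BoundedBelow l h' a b) : BoundedBelow l h a b := by
  induction h generalizing h' a b with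
  | atom c =>
    rcases c with q | t
    · induction h' generalizing a b with
      | atom c' =>
        rw [le_atom_atom] at hle
        cases hle with
        | inl hq =>
          obtain ⟨y, h1, h2, h3⟩ := hb
          exact ⟨y, h1, h2, hq.trans h3⟩
      | node κ ch' ih =>
        obtain ⟨j, hj⟩ := le_atom_node.1 hle
        obtain ⟨d, e, h1, -, h2, h3⟩ := hb.2 j a le_rfl hb.1
        exact (ih j h3 hj).mono_interval rfl h1 h2.le
    · trivial
  | node ι ch ih =>
    rcases h' with t | ⟨κ, ch'⟩
    · exact absurd hle (not_le_atom_of_starred hs t)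
    · rw [le_node_node] at hle
      refine ⟨hb.1, fun i c hac hcb => ?_⟩
      obtain ⟨j, hj⟩ := hle i
      obtain ⟨d, e, h1, h2, h3, h4⟩ := hb.2 j c hac hcb
      exact ⟨d, e, h1, h2, h3, ih i (hs.2 i) hj h4⟩

/-- A proper prefix of the first word is a finite sum of words bounded by elements of `h`. These are
placed one after another in the second word, where each element of `h` recurs cofinally, so room
always remains before `d`. -/
theorem wordEmb_of_bounds {h : WordSet.{u, v} Q} (h₁ : Bounds l h a b)
    (h₂ : BoundedBelow m h c d) : WordEmb l a b m c d := by
  induction h generalizing a b c d with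
  | atom t =>
    rcases t with q | t
    · obtain ⟨rfl, hq⟩ := h₁
      obtain ⟨y, hcy, hyd, hy⟩ := h₂
      refine ⟨fun _ => y, fun x hx x' hx' hlt => ?_, fun x hx => ?_⟩
      · exact absurd ((Order.lt_succ_iff.1 hx'.2).trans hx.1) (not_le.2 hlt)
      · obtain rfl := le_antisymm (Order.lt_succ_iff.1 hx.2) hx.1
        exact ⟨⟨hcy, hyd⟩, hq.trans hy⟩
    · exact h₁.elim
  | node ι ch ih =>
    refine WordEmb.of_forall_lt h₁.1 fun x hax hxb => ?_
    have : ∃ z, c ≤ z ∧ z < d ∧ WordEmb l a x m c z := by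
      have hr := h₁.2 x hax hxb
      clear hax hxb
      induction hr with
      | refl => exact ⟨c, le_rfl, h₂.1, WordEmb.of_empty l m a c c⟩
      | tail _ hi ih' =>
        obtain ⟨z, hcz, hzd, hz⟩ := ih'
        obtain ⟨i, hi⟩ := hi
        obtain ⟨d', e, h1, h2, h3, h4⟩ := h₂.2 i z hcz hzd
        exact ⟨e, hcz.trans (h1.trans h2), h3,
          hz.append ((ih i hi h4).mono h1 le_rfl) hcz (h1.trans h2)⟩
    obtain ⟨z, -, hzd, hz⟩ := this
    exact hz.mono le_rfl hzd.le

/-- The word on `[a, b)` is represented by `h`. -/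
structure Represents (l : Ordinal.{v} → Q) (h : WordSet.{u, v} Q) (a b : Ordinal.{v}) : Prop where
  starred : Starred h
  lt : a < b
  bounds : Bounds l h a b
  boundedBelow : BoundedBelow l h a b

theorem Represents.wordEmb {h h' : WordSet.{u, v} Q} (H : Represents l h a b)
    (H' : Represents m h' c d) (hle : Le (atomRel Q) h h') : WordEmb l a b m c d :=
  wordEmb_of_bounds H.bounds (H'.boundedBelow.of_le H.starred hle)

/-- The word on `[a, b)` is the sum of words represented by the members of a list. -/
inductive Decomposes (l : Ordinal.{v} → Q) :
    Ordinal.{v} → Ordinal.{v} → List (WordSet.{u, v} Q) → Prop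
  | nil (a : Ordinal.{v}) : Decomposes l a a []
  | cons {a b c : Ordinal.{v}} {h : WordSet.{u, v} Q} {L : List (WordSet.{u, v} Q)} :
      Represents l h a b → Decomposes l b c L → Decomposes l a c (h :: L)

theorem Decomposes.le {L : List (WordSet.{u, v} Q)} (h : Decomposes l a b L) : a ≤ b := by
  induction h with
  | nil => exact le_rfl
  | cons h _ ih => exact h.lt.le.trans ih

theorem Decomposes.append {L L' : List (WordSet.{u, v} Q)} (h : Decomposes l a b L)
    (h' : Decomposes l b c L') : Decomposes l a c (L ++ L') := by
  induction h with
  | nil => exact h'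
  | cons h _ ih => exact .cons h (ih h')

theorem Decomposes.exists_represents {L : List (WordSet.{u, v} Q)} (H : Decomposes l a b L)
    {h : WordSet.{u, v} Q} (hL : h ∈ L) : ∃ c d, a ≤ c ∧ d ≤ b ∧ Represents l h c d := by
  induction H with
  | nil => simp at hL
  | cons hr hd ih =>
    rcases List.mem_cons.1 hL with rfl | hL
    · exact ⟨_, _, le_rfl, hd.le, hr⟩
    · obtain ⟨c, d, h1, h2, h3⟩ := ih hL
      exact ⟨c, d, hr.lt.le.trans h1, h2, h3⟩

theorem Decomposes.reflTransGen {L : List (WordSet.{u, v} Q)} (H : Decomposes l a b L)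
    {ι : Type (v + 1)} {ch : ι → WordSet.{u, v} Q} (hL : ∀ h ∈ L, ∃ i, ch i = h) :
    Relation.ReflTransGen (fun x y => ∃ i, Bounds l (ch i) x y) a b := by
  induction H with
  | nil => exact .refl
  | cons hr _ ih =>
    obtain ⟨i, hi⟩ := hL _ List.mem_cons_self
    exact .head ⟨i, hi ▸ hr.bounds⟩ (ih fun h hh => hL h (List.mem_cons_of_mem _ hh))

theorem Decomposes.wordEmb {L L' : List (WordSet.{u, v} Q)} (H : Decomposes l a b L)
    (H' : Decomposes m c d L') (h : List.SublistForall₂ (Le (atomRel Q)) L L') :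
    WordEmb l a b m c d := by
  induction h generalizing a c with
  | nil =>
    cases H
    exact WordEmb.of_empty l m _ _ _
  | cons hle _ ih =>
    cases H with
    | cons hr H =>
      cases H' with
      | cons hr' H' => exact (hr.wordEmb hr' hle).append (ih H H') hr'.lt.le H'.le
  | cons_right _ ih =>
    cases H' with
    | cons hr' H' => exact (ih H H').mono hr'.lt.le le_rfl

theorem represents_letter (l : Ordinal.{v} → Q) (a : Ordinal.{v}) :
    Represents l (atom (Sum.inl (l a))) a (Order.succ a) :=
  ⟨trivial, Order.lt_succ a, ⟨rfl, le_rfl⟩, ⟨a, le_rfl, Order.lt_succ a, le_rfl⟩⟩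

/-- Some tail of a word of limit length has every represented interval recurring cofinally. -/
theorem exists_recurrent_tail
    (hwqo : ∀ e : ℕ → WordSet.{u, v} Q, ∃ i j, i < j ∧ Le (atomRel Q) (e i) (e j))
    (l : Ordinal.{v} → Q) (hab : a < b) :
    ∃ a', a ≤ a' ∧ a' < b ∧ ∀ c d h, a' ≤ c → d < b → Represents l h c d → ∀ z < b,
      ∃ c' d' h', z ≤ c' ∧ d' < b ∧ Represents l h' c' d' ∧ Le (atomRel Q) h h' := by
  by_contra! hcon
  -- Otherwise each tail contains a represented interval that does not recur beyond some point.
  -- Iterating from that point gives a sequence with no `h i` below a later `h j`.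
  have step : ∀ s : {s // a ≤ s ∧ s < b}, ∃ (h : WordSet.{u, v} Q) (c d : Ordinal.{v})
      (s' : {s // a ≤ s ∧ s < b}), s.1 ≤ c ∧ d < b ∧ Represents l h c d ∧ s.1 ≤ s'.1 ∧
        ∀ c' d' h', s'.1 ≤ c' → d' < b → Represents l h' c' d' → ¬ Le (atomRel Q) h h' := by
    rintro ⟨s, has, hsb⟩
    obtain ⟨c, d, h, h1, h2, h3, z, hz, h4⟩ := hcon s has hsb
    exact ⟨h, c, d, ⟨max s z, has.trans (le_max_left _ _), max_lt hsb hz⟩, h1, h2, h3,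
      le_max_left _ _, fun c' d' h' hc' => h4 c' d' h' ((le_max_right _ _).trans hc')⟩
  choose h c d next h1 h2 h3 h4 h5 using step
  let s : ℕ → {s // a ≤ s ∧ s < b} := fun n => next^[n] ⟨a, le_rfl, hab⟩
  have hs : ∀ n, s (n + 1) = next (s n) := fun n => Function.iterate_succ_apply' _ _ _
  have hmono : Monotone fun n => (s n).1 := monotone_nat_of_le_succ fun n => by
    rw [hs]; exact h4 _
  obtain ⟨i, j, hij, hle⟩ := hwqo fun n => h (s n)
  refine h5 (s i) (c (s j)) (d (s j)) (h (s j)) ?_ (h2 _) (h3 _) hle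
  rw [← hs]
  exact (hmono hij).trans (h1 _)

/-- Induction on `b`. At a limit, a recurrent tail is split off and coded by the set of all codes
used for its proper prefixes, together with the stars: those prefixes give the upper bound, and
recurrence gives the lower one. -/
theorem exists_decomposes
    (hwqo : ∀ e : ℕ → WordSet.{u, v} Q, ∃ i j, i < j ∧ Le (atomRel Q) (e i) (e j))
    (l : Ordinal.{v} → Q) {a b : Ordinal.{v}} (hab : a ≤ b) : ∃ L, Decomposes l a b L := by
  induction b using Ordinal.limitRecOn generalizing a with
  | zero => exact ⟨[], by obtain rfl := le_antisymm hab (zero_le); exact .nil _⟩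
  | add_one b ih =>
    rw [← Order.succ_eq_add_one] at hab ⊢
    rcases hab.lt_or_eq with hlt | rfl
    · obtain ⟨L, hL⟩ := ih (Order.lt_succ_iff.1 hlt)
      exact ⟨_, hL.append (.cons (represents_letter l b) (.nil _))⟩
    · exact ⟨[], .nil _⟩
  | limit b hb ih =>
    rcases hab.lt_or_eq with hlt | rfl
    swap
    · exact ⟨[], .nil _⟩
    obtain ⟨a', haa', ha'b, hrec⟩ := exists_recurrent_tail hwqo l hlt
    have hD : ∀ d : {d // a' ≤ d ∧ d < b}, ∃ L, Decomposes l a' d.1 L := fun d => ih d.1 d.2.2 d.2.1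
    choose D hD using hD
    let ch : Bool ⊕ (Σ d : {d // a' ≤ d ∧ d < b}, Fin (D d).length) → WordSet.{u, v} Q :=
      Sum.elim (fun t => atom (Sum.inr t)) fun p => (D p.1).get p.2
    have hch : ∀ p : Σ d : {d // a' ≤ d ∧ d < b}, Fin (D d).length,
        ∃ x y, a' ≤ x ∧ y < b ∧ Represents l ((D p.1).get p.2) x y := fun p => by
      obtain ⟨x, y, h1, h2, h3⟩ := (hD p.1).exists_represents (List.get_mem (D p.1) p.2)
      exact ⟨x, y, h1, h2.trans_lt p.1.2.2, h3⟩
    obtain ⟨L, hL⟩ := ih a' ha'b haa'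
    refine ⟨L ++ [node _ ch], hL.append (.cons ⟨⟨fun t => ⟨Sum.inl t, rfl⟩, ?_⟩, ha'b,
      ⟨hb, fun c hc hcb => ?_⟩, ha'b, ?_⟩ (.nil _))⟩
    · rintro (t | p)
      · trivial
      · obtain ⟨x, y, -, -, h⟩ := hch p
        exact h.starred
    · refine (hD ⟨c, hc, hcb⟩).reflTransGen fun h hh => ?_
      obtain ⟨n, rfl⟩ := List.get_of_mem hh
      exact ⟨Sum.inr ⟨_, n⟩, rfl⟩
    · rintro (t | p) c hc hcb
      · exact ⟨c, c, le_rfl, le_rfl, hcb, trivial⟩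
      · obtain ⟨x, y, h1, h2, h3⟩ := hch p
        obtain ⟨x', y', h', h4, h5, h6, h7⟩ := hrec x y _ h1 h2 h3 c hcb
        exact ⟨x', y', h4, h6.lt.le, h5, h6.boundedBelow.of_le h3.starred h7⟩

end WordSet

end Words

/-! ## Thinness in terms of alternating sets -/

namespace BadSeq

variable {W : Type u} [Preorder W]

theorem shift_iterate_apply (n : ℕ) (X : BadSeq W) (k : ℕ) : (shift^[n] X).1 k = X.1 (k + n) := by
  induction n generalizing X with
  | zero => rfl
  | succ n ih => rw [Function.iterate_succ_apply, ih]; rfl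

theorem adj_shift (X : BadSeq W) : (graph W).Adj X (shift X) := by
  refine (SimpleGraph.fromRel_adj _ _ _).2 ⟨fun h => X.2 0 ?_, Or.inl rfl⟩
  exact (congrArg (fun Y : BadSeq W => Y.1 0) h).le

theorem continuous_comp_apply {D : Type*} [TopologicalSpace D] (i : W → D) (k : ℕ) :
    Continuous fun X : BadSeq W => i (X.1 k) := by
  let : TopologicalSpace W := ⊥
  have : DiscreteTopology W := ⟨rfl⟩
  exact (continuous_of_discreteTopology (f := i)).comp
    ((continuous_apply k).comp continuous_induced_dom)

theorem continuous_shift : Continuous (shift : BadSeq W → BadSeq W) := by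
  let : TopologicalSpace W := ⊥
  refine continuous_induced_rng.2 (continuous_pi fun k => ?_)
  exact continuous_comp_apply id (k + 1)

theorem polishSpace [Countable W] : PolishSpace (BadSeq W) := by
  let : TopologicalSpace W := ⊥
  have : DiscreteTopology W := ⟨rfl⟩
  have hcl : IsClosed {X : ℕ → W | ∀ k, ¬ X k ≤ X (k + 1)} := by
    have : {X : ℕ → W | ∀ k, ¬ X k ≤ X (k + 1)} =
        ⋂ k, (fun X : ℕ → W => (X k, X (k + 1))) ⁻¹' {p | ¬ p.1 ≤ p.2} := by
      ext X; simp
    rw [this]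
    exact isClosed_iInter fun k => (isClosed_discrete _).preimage
      ((continuous_apply k).prodMk (continuous_apply (k + 1)))
  have hemb : IsClosedEmbedding (Subtype.val : BadSeq W → ℕ → W) :=
    ⟨⟨⟨rfl⟩, Subtype.val_injective⟩, by rwa [Subtype.range_val_subtype]⟩
  have hW : PolishSpace W := inferInstance
  exact hemb.polishSpace

end BadSeq

theorem exists_borelHom_of_borelChromaticNumber_le {V : Type u} [TopologicalSpace V]
    [PolishSpace V] {G : SimpleGraph V} {n : ℕ} (h : borelChromaticNumber G ≤ n) :
    ∃ (Y : Type u) (_ : TopologicalSpace Y), PolishSpace Y ∧ Finite Y ∧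
      BorelHom G (⊤ : SimpleGraph Y) := by
  have hne : {c | ∃ (Y : Type u) (_ : TopologicalSpace Y),
      PolishSpace Y ∧ BorelHom G (⊤ : SimpleGraph Y) ∧ #Y = c}.Nonempty :=
    ⟨#V, V, inferInstance, inferInstance,
      ⟨id, @measurable_id V (borel V), fun _ _ h => h.ne⟩, rfl⟩
  obtain ⟨Y, tY, hY, hom, hc⟩ := csInf_mem hne
  refine ⟨Y, tY, hY, ?_, hom⟩
  rw [← Cardinal.lt_aleph0_iff_finite, hc]
  exact lt_of_le_of_lt h (Cardinal.natCast_lt_aleph0)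

/-- A Borel colouring with finitely many colours yields a Borel set that alternates along every
orbit of the shift: the points where the colour increases. -/
theorem BadSeq.exists_alternating {W : Type u} [Preorder W] [Countable W]
    (h : borelChromaticNumber (BadSeq.graph W) ≤ 3) :
    ∃ P : Set (BadSeq W), @MeasurableSet _ (borel _) P ∧ ∀ X,
      (∃ᶠ n in atTop, BadSeq.shift^[n] X ∈ P) ∧ ∃ᶠ n in atTop, BadSeq.shift^[n] X ∉ P := by
  have := BadSeq.polishSpace (W := W)
  obtain ⟨Y, tY, hY, hfin, c, hc, hadj⟩ :=
    exists_borelHom_of_borelChromaticNumber_le (n := 3) (by exact_mod_cast h)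
  let : MeasurableSpace (BadSeq W) := borel _
  have : BorelSpace (BadSeq W) := ⟨rfl⟩
  let : MeasurableSpace Y := borel _
  have : BorelSpace Y := ⟨rfl⟩
  let i : Y → Fin (Nat.card Y) := Finite.equivFin Y
  have hi : Function.Injective i := (Finite.equivFin Y).injective
  have hmeas : Measurable fun X => i (c X) :=
    (measurable_of_countable i).comp hc
  have hne : ∀ X n, i (c (BadSeq.shift^[n] X)) ≠ i (c (BadSeq.shift^[n + 1] X)) := fun X n h => by
    rw [Function.iterate_succ_apply'] at h
    exact hadj _ _ (BadSeq.adj_shift _) (hi h)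
  refine ⟨{X | i (c X) < i (c (BadSeq.shift X))},
    measurableSet_lt hmeas (hmeas.comp BadSeq.continuous_shift.measurable), fun X => ⟨?_, ?_⟩⟩
  · intro hev
    obtain ⟨N, hN⟩ := Filter.eventually_atTop.1 hev
    have : StrictAnti fun n => i (c (BadSeq.shift^[N + n] X)) := strictAnti_nat_of_succ_lt
      fun n => by
        have h1 : ¬ i (c _) < i (c (BadSeq.shift (BadSeq.shift^[N + n] X))) :=
          hN (N + n) (Nat.le_add_right _ _)
        rw [← Function.iterate_succ_apply' BadSeq.shift] at h1
        exact lt_of_le_of_ne (not_lt.1 h1) (hne X (N + n)).symm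
    exact not_injective_infinite_finite _ this.injective
  · intro hev
    obtain ⟨N, hN⟩ := Filter.eventually_atTop.1 hev
    have : StrictMono fun n => i (c (BadSeq.shift^[N + n] X)) := strictMono_nat_of_lt_succ
      fun n => by
        have h1 := not_not.1 (hN (N + n) (Nat.le_add_right _ _))
        rw [Set.mem_ofPred_eq, ← Function.iterate_succ_apply' BadSeq.shift] at h1
        exact h1
    exact not_injective_infinite_finite _ this.injective

/-- The map sending `x` to the values of `f` along its orbit intertwines the shifts, so an
alternating set of bad sequences can be pulled back. -/
theorem IsThin.alternatesOnBad {Q : Type u} [Preorder Q] (hQ : IsThin Q) :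
    AlternatesOnBad ((· ≤ ·) : Q → Q → Prop) := fun f hf => by
  have : Countable (Set.range f) := hf.countable_range
  obtain ⟨P, hP, h⟩ := BadSeq.exists_alternating (hQ.2 _ hf.countable_range)
  let : TopologicalSpace (Set.range f) := ⊥
  have : DiscreteTopology (Set.range f) := ⟨rfl⟩
  let : MeasurableSpace (Set.range f) := ⊤
  have : BorelSpace (Set.range f) := ⟨borel_eq_top_of_discrete.symm⟩
  -- `G x` need not be bad for every `x`, so `P` is first extended to a Borel set of all sequences.
  obtain ⟨P', hP', rfl⟩ : ∃ P' : Set (ℕ → Set.range f), MeasurableSet P' ∧ Subtype.val ⁻¹' P' = P := by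
    have hcomap := borel_comap (f := (Subtype.val : BadSeq (Set.range f) → ℕ → Set.range f))
      (t := inferInstance)
    have hP2 : @MeasurableSet _ (@borel _ (TopologicalSpace.induced
      (Subtype.val : BadSeq (Set.range f) → ℕ → Set.range f) inferInstance)) P := hP
    rw [hcomap, ← BorelSpace.measurable_eq] at hP2
    exact hP2
  let G : (ℕ → ℕ) → ℕ → Set.range f := fun x n => ⟨f (shiftSeq^[n] x), _, rfl⟩
  have hG : Measurable G := measurable_pi_lambda _ fun n s _ => by
    have : (fun x => G x n) ⁻¹' s = shiftSeq^[n] ⁻¹' (f ⁻¹' (Subtype.val '' s)) := by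
      ext x; simp [G]
    rw [this]
    exact (measurable_shiftSeq.iterate n) (hf.preimage _)
  refine ⟨G ⁻¹' P', hG hP', fun x hx => ?_⟩
  let X : BadSeq (Set.range f) := ⟨G x, hx⟩
  have key : ∀ n, BadSeq.shift^[n] X ∈ (Subtype.val ⁻¹' P' : Set (BadSeq (Set.range f))) ↔
      shiftSeq^[n] x ∈ G ⁻¹' P' := fun n => by
    have : (BadSeq.shift^[n] X).1 = G (shiftSeq^[n] x) := funext fun k => by
      rw [BadSeq.shift_iterate_apply]
      exact Subtype.ext (by simp only [X, G, Function.iterate_add_apply])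
    change (BadSeq.shift^[n] X).1 ∈ P' ↔ G (shiftSeq^[n] x) ∈ P'
    rw [this]
  exact ⟨(h X).1.mono fun n hn => (key n).1 hn, (h X).2.mono fun n hn hn' => hn ((key n).2 hn')⟩

theorem borelChromaticNumber_le_three {V : Type u} [TopologicalSpace V] {G : SimpleGraph V}
    {c : V → Fin 3} (hc : @Measurable _ _ (borel V) ⊤ c) (hadj : ∀ x y, G.Adj x y → c x ≠ c y) :
    borelChromaticNumber G ≤ 3 := by
  let : TopologicalSpace (ULift.{u} (Fin 3)) := ⊥
  have : DiscreteTopology (ULift.{u} (Fin 3)) := ⟨rfl⟩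
  refine csInf_le' ⟨ULift.{u} (Fin 3), inferInstance, inferInstance,
    ⟨fun x => ULift.up (c x), fun s _ => ?_, fun x y h h' => ?_⟩, by simp⟩
  · exact hc (t := ULift.up ⁻¹' s) trivial
  · exact hadj x y h (congrArg ULift.down h')

namespace AlternatesOnBad

variable {W : Type u} [Preorder W]

/-- Every orbit reaches the set `A` of exits from `P`, and never at two consecutive times. Colour 2
marks `A`; the parity of the waiting time colours the rest. -/
theorem borelChromaticNumber_le (hW : AlternatesOnBad ((· ≤ ·) : W → W → Prop)) {Q' : Set W}
    (hQ' : Q'.Countable) : borelChromaticNumber (BadSeq.graph Q') ≤ 3 := by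
  let : MeasurableSpace (BadSeq Q') := borel _
  have : BorelSpace (BadSeq Q') := ⟨rfl⟩
  rcases isEmpty_or_nonempty Q' with hem | hne
  · exact borelChromaticNumber_le_three (c := fun _ => 0) measurable_const
      fun X => (hem.false (X.1 0)).elim
  have : Countable Q' := hQ'
  obtain ⟨i, hi⟩ := Countable.exists_injective_nat Q'
  -- Decoding the first coordinate along the orbit of `J X` reads back the bad sequence `X`.
  obtain ⟨P, hP, h⟩ := hW _ (CountablyMeasurable.apply_zero fun n => ((Function.invFun i n : Q') : W))
  let J : BadSeq Q' → ℕ → ℕ := fun X k => i (X.1 k)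
  have hJ : Measurable J := measurable_pi_lambda _ fun k =>
    (BadSeq.continuous_comp_apply i k).measurable
  have hshift : Measurable (BadSeq.shift : BadSeq Q' → BadSeq Q') :=
    BadSeq.continuous_shift.measurable
  let A : Set (BadSeq Q') := {X | J X ∈ P ∧ J (BadSeq.shift X) ∉ P}
  have hA : MeasurableSet A := (hJ hP).inter ((hJ.comp hshift) hP).compl
  have hJn : ∀ X n, J (BadSeq.shift^[n] X) = shiftSeq^[n] (J X) := fun X n => funext fun k => by
    rw [shiftSeq_iterate_apply]
    exact congrArg i (BadSeq.shift_iterate_apply n X k)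
  have hrec : ∀ X, ∃ n, BadSeq.shift^[n] X ∈ A := fun X => by
    have halt := h (J X) fun n hn => by
      simp only [shiftSeq_iterate_apply, J, Function.leftInverse_invFun hi _] at hn
      refine X.2 n ?_
      simpa [Nat.zero_add] using hn
    by_contra! hcon
    obtain ⟨N, hN⟩ := halt.1.exists
    have : ∀ n ≥ N, shiftSeq^[n] (J X) ∈ P := fun n hn => by
      induction n, hn using Nat.le_induction with
      | base => exact hN
      | succ n _ ih =>
        by_contra hn
        refine hcon n ⟨by rwa [hJn], ?_⟩
        rwa [← Function.iterate_succ_apply' BadSeq.shift, hJn]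
    obtain ⟨n, hn, hn'⟩ := (Filter.frequently_atTop.1 halt.2) N
    exact hn' (this n hn)
  classical
  let N : BadSeq Q' → ℕ := fun X => Nat.find (hrec X)
  have hN : Measurable N := measurable_find hrec fun n => (hshift.iterate n) hA
  have hcol : ∀ X : BadSeq Q', (if N X = 0 then 2 else if Even (N X) then 1 else 0 : Fin 3) ≠
      if N (BadSeq.shift X) = 0 then 2 else if Even (N (BadSeq.shift X)) then 1 else 0 := fun X => by
    have hspec : BadSeq.shift^[N X] X ∈ A := Nat.find_spec (hrec X)
    rcases hNX : N X with _ | n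
    · have h1 : N (BadSeq.shift X) ≠ 0 := fun h0 => by
        have hspec' : BadSeq.shift^[N (BadSeq.shift X)] (BadSeq.shift X) ∈ A :=
          Nat.find_spec (hrec (BadSeq.shift X))
        rw [hNX] at hspec
        rw [h0] at hspec'
        exact hspec.2 hspec'.1
      rw [if_pos rfl, if_neg h1]
      split_ifs <;> decide
    · have h1 : N (BadSeq.shift X) = n := by
        refine (Nat.find_eq_iff (hrec (BadSeq.shift X))).2 ⟨?_, fun k hk hk' => ?_⟩
        · rwa [hNX] at hspec
        · exact Nat.find_min (hrec X) (m := k + 1) (by change k + 1 < N X; omega) hk'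
      rw [h1, if_neg (Nat.succ_ne_zero n)]
      by_cases h0 : n = 0
      · subst h0
        simp
      · rw [if_neg h0]
        by_cases hev : Even n <;> simp [Nat.even_add_one, hev]
  refine borelChromaticNumber_le_three
    (c := fun X => if N X = 0 then 2 else if Even (N X) then 1 else 0)
    ((measurable_from_top (f := fun n : ℕ =>
      (if n = 0 then 2 else if Even n then 1 else 0 : Fin 3))).comp hN) fun X Y hXY => ?_
  rcases ((SimpleGraph.fromRel_adj _ _ _).1 hXY).2 with rfl | rfl
  · exact hcol X
  · exact (hcol Y).symm

/-- Galvin–Prikry makes the good points homogeneous; a set all of whose subsets are bad would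
contradict `exists_rel`. -/
theorem isBQO (hW : AlternatesOnBad ((· ≤ ·) : W → W → Prop)) : IsBQO W := fun f hf => by
  let : TopologicalSpace W := ⊥
  have : DiscreteTopology W := ⟨rfl⟩
  classical
  have : SecondCountableTopology InfSubset :=
    (IsInducing.mk rfl : IsInducing (Subtype.val : InfSubset → ℕ → ℕ)).secondCountableTopology
  -- The constant value off the increasing sequences only serves to make `F` total; `F` is compared
  -- only at increasing sequences.
  let F : (ℕ → ℕ) → W := fun x => if h : StrictMono x then f ⟨x, h⟩ else f ⟨id, strictMono_id⟩
  have hFf : ∀ B : InfSubset, F B.1 = f B := fun B => dif_pos B.2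
  have hopen : ∀ c, IsOpen (f ⁻¹' {c}) := fun c => (isOpen_discrete _).preimage hf
  have hSM : MeasurableSet {x : ℕ → ℕ | StrictMono x} := by
    have : {x : ℕ → ℕ | StrictMono x} = ⋂ n, {x | x n < x (n + 1)} := by
      ext x
      simp only [Set.mem_ofPred_eq, Set.mem_iInter]
      exact ⟨fun h n => h (Nat.lt_succ_self n), strictMono_nat_of_lt_succ⟩
    rw [this]
    exact MeasurableSet.iInter fun n =>
      measurableSet_lt (measurable_pi_apply n) (measurable_pi_apply (n + 1))
  have hF : CountablyMeasurable F :=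
    { countable_range := by
        have : (Set.range f).Countable :=
          Set.PairwiseDisjoint.countable_of_isOpen (s := fun c => f ⁻¹' {c})
            (fun c _ d _ hcd => Disjoint.preimage f (Set.disjoint_singleton.2 hcd))
            (fun c _ => hopen c) (by rintro _ ⟨B, rfl⟩; exact ⟨B, rfl⟩)
        refine this.mono ?_
        rintro _ ⟨x, rfl⟩
        dsimp only [F]
        split_ifs
        exacts [⟨_, rfl⟩, ⟨_, rfl⟩]
      measurableSet_fiber := fun c => by
        obtain ⟨O, hO, hOc⟩ := isOpen_induced_iff.1 (hopen c)
        have : F ⁻¹' {c} = ({x : ℕ → ℕ | StrictMono x} ∩ O) ∪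
            ({x : ℕ → ℕ | StrictMono x}ᶜ ∩ {_x | f ⟨id, strictMono_id⟩ = c}) := by
          ext x
          by_cases hx : StrictMono x
          · have h2 : x ∈ O ↔ f ⟨x, hx⟩ = c := Set.ext_iff.1 hOc ⟨x, hx⟩
            simp [F, hx, h2]
          · simp [F, hx]
        rw [this]
        exact (hSM.inter hO.measurableSet).union (hSM.compl.inter (MeasurableSet.const _)) }
  obtain ⟨a, ha, hom⟩ := galvin_prikry
    ((hF.map₂ (hF.comp_measurable measurable_shiftSeq) (· ≤ ·)).preimage {True})
  rcases hom with hom | hom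
  · refine ⟨⟨a, ha⟩, fun B hB => ?_⟩
    choose y hy using fun k => hB ⟨k, rfl⟩
    replace hy : ∀ k, a (y k) = B.1 k := hy
    have hBy : a ∘ y = B.1 := funext hy
    have hymono : StrictMono y := fun i j hij => by
      rw [← ha.lt_iff_lt, hy, hy]
      exact B.2 hij
    have := of_eq_true (hom y hymono)
    rw [hBy] at this
    rw [← hFf, ← hFf]
    exact this
  · exfalso
    have hcomp : Measurable fun x : ℕ → ℕ => a ∘ x := measurable_pi_lambda _ fun k =>
      (measurable_from_top (f := a)).comp (measurable_pi_apply k)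
    obtain ⟨x, hx, hle⟩ := hW.exists_rel (hF.comp_measurable hcomp)
    exact hom x hx (eq_true hle)

theorem isThin (hW : AlternatesOnBad ((· ≤ ·) : W → W → Prop)) : IsThin W :=
  ⟨hW.isBQO, fun _ hQ' => hW.borelChromaticNumber_le hQ'⟩

end AlternatesOnBad

/-! ### Labelled ordinals as lists of hereditary sets. -/

namespace LabelledOrdinal

variable {Q : Type u} [Preorder Q] {κ : Cardinal.{v}}

open Classical in
/-- The labelling of `a`, extended to all ordinals by the value `q`. -/
noncomputable def extendLabel (q : Q) (a : LabelledOrdinal Q κ) (x : Ordinal.{v}) : Q :=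
  if h : x < a.len then a.label ⟨x, h⟩ else q

theorem le_of_wordEmb {q : Q} {a b : LabelledOrdinal Q κ}
    (h : WordEmb (a.extendLabel q) 0 a.len (b.extendLabel q) 0 b.len) : a ≤ b := by
  obtain ⟨f, f1, f2⟩ := h
  refine ⟨fun x => ⟨f x.1, (f2 x.1 ⟨zero_le, x.2⟩).1.2⟩, fun x y hxy =>
    f1 ⟨zero_le, x.2⟩ ⟨zero_le, y.2⟩ hxy, fun x => ?_⟩
  have hx := f2 x.1 ⟨zero_le, x.2⟩
  have h1 := hx.2
  have hx1 : x.1 < a.len := x.2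
  rw [extendLabel, extendLabel, dif_pos hx1, dif_pos hx.1.2] at h1
  exact h1

theorem alternatesOnBad (hQ : AlternatesOnBad ((· ≤ ·) : Q → Q → Prop)) :
    AlternatesOnBad ((· ≤ ·) : LabelledOrdinal Q κ → LabelledOrdinal Q κ → Prop) := by
  -- Without letters every labelled ordinal is empty, so there are no bad orbits.
  rcases isEmpty_or_nonempty Q with hem | ⟨⟨q⟩⟩
  · intro f _
    refine ⟨∅, MeasurableSet.empty, fun x hx => (hx 0 ?_).elim⟩
    exact ⟨fun y => hem.elim ((f _).label y), fun y => hem.elim ((f _).label y),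
      fun y => hem.elim ((f _).label y)⟩
  have : Inhabited (Q ⊕ Bool) := ⟨Sum.inr true⟩
  have : Inhabited (WordSet.{u, v} Q) := ⟨.atom default⟩
  have hset : AlternatesOnBad (HSet.Le.{u, v + 1} (atomRel Q)) :=
    (hQ.sum AlternatesOnBad.bool).hset
  choose L hL using fun a : LabelledOrdinal Q κ =>
    WordSet.exists_decomposes hset.exists_lt_rel (a.extendLabel q) (zero_le (a := a.len))
  exact hset.list.of_map L fun a b h => le_of_wordEmb ((hL a).wordEmb (hL b) h)

end LabelledOrdinal

theorem lemma3p9 {Q : Type u} [Preorder Q] (hQ : IsThin Q) (κ : Cardinal.{v}) :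
    IsThin (LabelledOrdinal Q κ) :=
  (LabelledOrdinal.alternatesOnBad hQ.alternatesOnBad).isThin
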